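/- All graphs are oriented graphs $\mathcal G$ with a countable set of vertices $V(\mathcal G)$ and at most one arrow $u\to v$ for each ordered pair $(u,v)$ of vertices (loops allowed). A closed path of length $p$ at $u$ is a sequence of vertices $(u_1,\dots,u_{p+1})$ with $u_1=u_{p+1}=u$ and $u_i\to u_{i+1}$ for $1\le i\le p$; let $\Delta^u_p(\mathcal G)$ be the set of these. It decomposes uniquely into first returns at $u$ (the pieces between consecutive visits to $u$); let $\Delta^u_{p,M}(\mathcal G)\subset\Delta^u_p(\mathcal G)$ be the set of those all of whose first returns have length at most $M$. The graph $\mathcal G$ is admissible if $\Delta^u_p(\mathcal G)$ is finite for all $u\in V(\mathcal G)$ and $p\in\mathbb N$, and connected if any ordered pair of vertices is joined by an oriented path. Let $\Sigma(\mathcal G)=\{(v_k)_{k\in\mathbb Z}\in V(\mathcal G)^{\mathbb Z}:\ v_k\to v_{k+1}\ \forall k\}$, with the topology induced by the product of the discrete topologies, and let $\sigma$ be the shift on it. Let $\mathcal M(\Sigma(\mathcal G))$ be the set of $\sigma$-invariant Borel probability measures, let $h(\sigma,\xi)$ be the Kolmogorov–Sinai entropy of $\xi\in\mathcal M(\Sigma(\mathcal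 G))$, and let $h(\mathcal G)=\sup_{\xi\in\mathcal M(\Sigma(\mathcal G))}h(\sigma,\xi)\in[-\infty,+\infty]$, with $\sup\emptyset=-\infty$. A measure $\xi\in\mathcal M(\Sigma(\mathcal G))$ is maximal if $h(\sigma,\xi)=h(\mathcal G)$. Let $E=\bigcup_{L\in\mathcal L}E_L$ be a set with a family of subsets $(E_L)_{L\in\mathcal L}$. Let $(\mathcal G_n)_{n\in\mathbb N}$ be a sequence of admissible graphs with vertices in $E$ that is uniform with respect to $(E_L)_L$, i.e. $\sup_n\sharp\big(V(\mathcal G_n)\cap E_L\big)<+\infty$ for every $L\in\mathcal L$. Assume that $(\mathcal G_n)_n$ converges to a graph $\mathcal G$, i.e. for every $L\in\mathcal L$ and every integer $M\ge1$ there is $n_0$ such that for all $n>n_0$ and all $u^n\in V(\mathcal G_n)\cap E_L$ there is $u\in V(\mathcal G)$ with $$\sharp\Delta^{u^n}_{p,M}(\mathcal G_n)\le\sharp\Delta^u_p(\mathcal G)\qquad\text{for all }p\in\mathbb N .$$ Let $\mathcal G'_n\subset\mathcal G_n$ be finite connected subgraphs such that $\lim_n h(\mathcal G'_n)$ exists in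 $[-\infty,+\infty]$ and $\lim_n h(\mathcal G'_n)>h(\mathcal G)$. For every $n$ let $\mu_n\in\mathcal M(\Sigma(\mathcal G'_n))\subset\mathcal M(\Sigma(\mathcal G_n))$ be the maximal measure (Parry measure) of $\Sigma(\mathcal G'_n)$. Then $(\mu_n)_n$ goes to infinity: for every $L\in\mathcal L$, $$\lim_{n\to\infty}\mu_n\big(\{(v_k)_k\in\Sigma(\mathcal G_n):\ v_0\in E_L\}\big)=0 .$$ -/

import Mathlib

open Set Filter Topology MeasureTheory

/-! ### Measure-theoretic entropy -/

section Entropy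

variable {α : Type*} [MeasurableSpace α]

/-- The Shannon entropy, with respect to `μ`, of the joined partition
`P ∨ T⁻¹P ∨ ⋯ ∨ T⁻⁽ⁿ⁻¹⁾P`, for a finite partition given by its label map `P : α → Fin k`. -/
noncomputable def joinEntropy (T : α → α) (μ : Measure α) {k : ℕ} (P : α → Fin k) (n : ℕ) : ℝ :=
  ∑ w : Fin n → Fin k, Real.negMulLog (μ.real {x | ∀ i : Fin n, P (T^[i] x) = w i})

/-- The entropy of `T` and `μ` relative to the finite partition `P`. -/
noncomputable def partitionEntropy (T : α → α) (μ : Measure α) {k : ℕ} (P : α → Fin k) : EReal :=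
  limsup (fun n : ℕ => ((joinEntropy T μ P n / n : ℝ) : EReal)) atTop

/-- The Kolmogorov–Sinai entropy `h(T, μ)`: the supremum over all finite measurable partitions. -/
noncomputable def ksEntropy (T : α → α) (μ : Measure α) : EReal :=
  ⨆ (k : ℕ) (P : α → Fin k) (_ : Measurable P), partitionEntropy T μ P

end Entropy

/-! ### Countable oriented graphs and their Markov shifts -/

/-- An oriented graph (loops allowed, at most one arrow from one vertex to another) whose vertices
form a countable subset of `E`. -/
structure OrientedGraph (E : Type*) where
  verts : Set E
  Adj : E → E → Prop
  countable_verts : verts.Countable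
  left_mem : ∀ {u v : E}, Adj u v → u ∈ verts
  right_mem : ∀ {u v : E}, Adj u v → v ∈ verts

namespace OrientedGraph

variable {E : Type*}

/-- The subgraph relation: fewer vertices and fewer arrows. -/
def IsSubgraph (G' G : OrientedGraph E) : Prop :=
  G'.verts ⊆ G.verts ∧ ∀ u v : E, G'.Adj u v → G.Adj u v

/-- Any ordered pair of vertices is joined by an oriented path. -/
def IsConnected (G : OrientedGraph E) : Prop :=
  ∀ u ∈ G.verts, ∀ v ∈ G.verts, Relation.ReflTransGen G.Adj u v

/-- The closed paths `(γ 0, …, γ p)` of length `p` at `u`. -/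
def closedPaths (G : OrientedGraph E) (u : E) (p : ℕ) : Set (Fin (p + 1) → E) :=
  {γ | γ 0 = u ∧ γ (Fin.last p) = u ∧ (∀ i, γ i ∈ G.verts) ∧
    ∀ i : Fin p, G.Adj (γ i.castSucc) (γ i.succ)}

/-- The closed paths of length `p` at `u` all of whose first returns at `u`
(the pieces between two consecutive visits to `u`) have length at most `M`. -/
def closedPathsLE (G : OrientedGraph E) (u : E) (p M : ℕ) : Set (Fin (p + 1) → E) :=
  {γ | γ ∈ G.closedPaths u p ∧
    ∀ i j : Fin (p + 1), i < j → γ i = u → γ j = u → (∀ k, i < k → k < j → γ k ≠ u) →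
      (j : ℕ) - (i : ℕ) ≤ M}

/-- At every vertex there are only finitely many closed paths of any given length. -/
def IsAdmissible (G : OrientedGraph E) : Prop :=
  ∀ M : ℕ, ∀ u ∈ G.verts, (G.closedPaths u M).Finite

/-- The space `Σ(G)` of two-sided infinite paths in `G`. -/
def ShiftSpace (G : OrientedGraph E) : Type _ :=
  {x : ℤ → G.verts // ∀ n : ℤ, G.Adj (x n) (x (n + 1))}

/-- The topology induced by the product of the discrete topologies. -/
instance (G : OrientedGraph E) : TopologicalSpace G.ShiftSpace :=
  letI : TopologicalSpace G.verts := ⊥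
  inferInstanceAs (TopologicalSpace {x : ℤ → G.verts // ∀ n : ℤ, G.Adj (x n) (x (n + 1))})

/-- The σ-algebra generated by the coordinates; it is the Borel σ-algebra, as shown below. -/
instance (G : OrientedGraph E) : MeasurableSpace G.ShiftSpace :=
  letI : MeasurableSpace G.verts := ⊤
  inferInstanceAs (MeasurableSpace {x : ℤ → G.verts // ∀ n : ℤ, G.Adj (x n) (x (n + 1))})

instance (G : OrientedGraph E) : BorelSpace G.ShiftSpace := by
  let : TopologicalSpace G.verts := ⊥
  let : MeasurableSpace G.verts := ⊤
  have : DiscreteTopology G.verts := ⟨rfl⟩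
  have : Countable G.verts := G.countable_verts.to_subtype
  have : BorelSpace G.verts := ⟨borel_eq_top_of_discrete.symm⟩
  exact inferInstanceAs (BorelSpace {x : ℤ → G.verts // ∀ n : ℤ, G.Adj (x n) (x (n + 1))})

/-- The shift map `σ` on `Σ(G)`. -/
def shift (G : OrientedGraph E) (x : G.ShiftSpace) : G.ShiftSpace :=
  ⟨fun n => x.1 (n + 1), fun n => x.2 (n + 1)⟩

/-- The set `[F]` of the infinite paths whose zeroth vertex lies in `F`. -/
def cylinder (G : OrientedGraph E) (F : Set E) : Set G.ShiftSpace :=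
  {x | (x.1 0 : E) ∈ F}

/-- The inclusion `Σ(G') ⊆ Σ(G)` for a subgraph `G'` of `G`. -/
def shiftInclusion {G' G : OrientedGraph E} (h : G'.IsSubgraph G) (x : G'.ShiftSpace) :
    G.ShiftSpace :=
  ⟨fun n => ⟨x.1 n, h.1 (x.1 n).2⟩, fun n => h.2 _ _ (x.2 n)⟩

theorem measurable_shiftInclusion {G' G : OrientedGraph E} (h : G'.IsSubgraph G) :
    Measurable (shiftInclusion h) := by
  let : MeasurableSpace G.verts := ⊤
  let : MeasurableSpace G'.verts := ⊤
  refine Measurable.subtype_mk (measurable_pi_lambda _ fun n => ?_)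
  have h1 : Measurable (fun v : G'.verts => (⟨v, h.1 v.2⟩ : G.verts)) := measurable_from_top
  have h2 : Measurable (fun x : G'.ShiftSpace => x.1 n) :=
    (measurable_pi_apply n).comp measurable_subtype_coe
  exact h1.comp h2

/-- The set `ℳ(Σ(G))` of the shift-invariant Borel probability measures. -/
def invariantMeasures (G : OrientedGraph E) : Set (Measure G.ShiftSpace) :=
  {μ | IsProbabilityMeasure μ ∧ MeasurePreserving G.shift μ μ}

/-- The Gurevich entropy `h(G)`: the supremum of `h(σ, μ)` over the invariant probability measures
(it is `⊥` if there are none). -/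
noncomputable def entropy (G : OrientedGraph E) : EReal :=
  ⨆ μ ∈ G.invariantMeasures, ksEntropy G.shift μ

/-- `μ` is a measure of maximal entropy of `Σ(G)`. -/
def IsMaximalMeasure (G : OrientedGraph E) (μ : Measure G.ShiftSpace) : Prop :=
  μ ∈ G.invariantMeasures ∧ ksEntropy G.shift μ = G.entropy

/-! ### Uniform families, convergence, and measures going to infinity -/

/-- A family of admissible graphs that is uniform with respect to `(F L)_L`. -/
def IsUniform {ι Λ : Type*} (F : Λ → Set E) (G : ι → OrientedGraph E) : Prop :=
  (∀ i, (G i).IsAdmissible) ∧ ∀ L, (⨆ i, ((G i).verts ∩ F L).encard) < ⊤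

/-- Convergence of a sequence of graphs, relative to `(F L)_L`, to a graph `H`. -/
def ConvergesTo {Λ W : Type*} (F : Λ → Set E) (G : ℕ → OrientedGraph E) (H : OrientedGraph W) :
    Prop :=
  ∀ L, ∀ M : ℕ, 0 < M → ∃ n₀ : ℕ, ∀ n, n₀ < n → ∀ v ∈ (G n).verts ∩ F L, ∃ u ∈ H.verts,
    ∀ p : ℕ, ((G n).closedPathsLE v p M).encard ≤ (H.closedPaths u p).encard

/-- A sequence of measures on the spaces `Σ(G n)` goes to infinity. -/
def GoesToInfinity {Λ : Type*} (F : Λ → Set E) (G : ℕ → OrientedGraph E)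
    (ξ : ∀ n, Measure (G n).ShiftSpace) : Prop :=
  ∀ L, Tendsto (fun n => ξ n ((G n).cylinder (F L))) atTop (𝓝 0)

end OrientedGraph

/-! ### Counting walks in a finite graph -/

section WalkCounting

/-! Fix reals h(H) < h₀ < h₁ < ℓ, take n large, a vertex v of G'_n in E_L, and let h = h(G'_n) > h₁.
Freely concatenating N closed paths of length p at a vertex of H produces entropy log N / p, so H
has at most e^{h₀p} closed paths of length p at any vertex (`encard_closedPaths_le`). By convergence
the same bound holds in G'_n at v for closed paths with first returns of length at most M.

Let F be the generating function of the first returns at v, and F_M its truncation to lengths at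
most M. The renewal equation gives F(e^{-h}) ≤ 1 and F_M(e^{-h₀}) ≤ 1 (`renewal_sum_le_one`), hence
F_M(e^{-h}) ≤ e^{-(h₁-h₀)} < 1. At z = e^{-(h+1/M)} the returns longer than M are damped by a factor
at most e^{-1}, so F(z) ≤ 1 - 1/C with C independent of n and M. The series of all closed paths,
R(z) = 1/(1 - F(z)), is therefore at most C (`walkSum_le`).

A variational inequality turns this into a bound on mass. For every positive vector r, h(σ,μ) ≤ ∫
log(Ar/r)(x₀) dμ, where A is the adjacency matrix (`ksEntropy_le_integral`). If r(a) is the series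
at z of the walks from a to v, then zAr = r - 1_v, and the integrand is at most h + 1/M - 1_v/r(v).
Since μ_n has entropy h, v has mass at most R(z)/M ≤ C/M (`IsMaximalMeasure.measureReal_vertex_le`).
At most K vertices lie in E_L, so its cylinder has mass at most KC/M, with M arbitrary. Only the
maximality of the Parry measure is used, not its explicit form. -/

open Classical in
/-- The number of walks of length `p` from `a` to `v`. -/
noncomputable def walkCount {V : Type*} [Fintype V] (A : V → V → Prop) (v : V) : ℕ → V → ℕ
  | 0, a => if a = v then 1 else 0
  | p + 1, a => ∑ b, if A a b then walkCount A v p b else 0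

open Classical in
/-- The number of walks of length `k + 1` from `a` to `v` that visit `v` only at their end
(and possibly at their start). -/
noncomputable def firstPassageCount {V : Type*} [Fintype V] (A : V → V → Prop) (v : V) :
    ℕ → V → ℕ
  | 0, a => if A a v then 1 else 0
  | k + 1, a => ∑ b, if A a b ∧ b ≠ v then firstPassageCount A v k b else 0

open Classical in
/-- The number of walks of length `p` from `a` to `v` that first arrive at `v` after at most `t`
steps and whose first returns at `v` have length at most `M`. -/
noncomputable def clockCount {V : Type*} [Fintype V] (A : V → V → Prop) (v : V) (M : ℕ) :
    ℕ → ℕ → V → ℕ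
  | 0, _, a => if a = v then 1 else 0
  | _ + 1, 0, _ => 0
  | p + 1, t + 1, a => ∑ b, if A a b then clockCount A v M p (if b = v then M else t) b else 0

open Classical in
/-- The walks counted by `clockCount`. -/
noncomputable def clockPaths {V : Type*} [Fintype V] (A : V → V → Prop) (v : V) (M : ℕ) :
    (p : ℕ) → ℕ → V → Finset (Fin (p + 1) → V)
  | 0, _, a => if a = v then {fun _ => a} else ∅
  | _ + 1, 0, _ => ∅
  | p + 1, t + 1, a => (Finset.univ.filter (A a)).biUnion fun b =>
      (clockPaths A v M p (if b = v then M else t) b).image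
        (Fin.cons (α := fun _ => V) a)

variable {V : Type*} [Fintype V] {A : V → V → Prop} {v : V}

/-- Cut a walk at its first arrival at `v` after time 0. For `a = v` this is the renewal equation.
-/
theorem walkCount_succ_eq_sum_antidiagonal (p : ℕ) (a : V) :
    walkCount A v (p + 1) a =
      ∑ ij ∈ Finset.HasAntidiagonal.antidiagonal p, firstPassageCount A v ij.1 a * walkCount A v ij.2 v := by
  classical
  induction p generalizing a with
  | zero =>
    simp only [walkCount, firstPassageCount, Finset.Nat.antidiagonal_zero, Finset.sum_singleton]
    rw [Finset.sum_eq_single v] <;> simp +contextual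
  | succ p ih =>
    rw [Finset.Nat.sum_antidiagonal_succ]
    simp only [firstPassageCount]
    -- A first step into `v` is already the first passage; any other first step is handled by
    -- induction.
    rw [walkCount, ← Finset.add_sum_erase _ _ (Finset.mem_univ v)]
    congr 1
    · simp
    · have : ∀ b ∈ Finset.univ.erase v, (if A a b then walkCount A v (p + 1) b else 0) =
          ∑ ij ∈ Finset.HasAntidiagonal.antidiagonal p, (if A a b ∧ b ≠ v then
            firstPassageCount A v ij.1 b else 0) * walkCount A v ij.2 v := by
        intro b hb
        have hb : b ≠ v := by simpa using hb
        by_cases h : A a b <;> simp [h, hb, ih]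
      rw [Finset.sum_congr rfl this, Finset.sum_comm]
      refine Finset.sum_congr rfl fun ij _ => ?_
      rw [Finset.sum_mul, ← Finset.add_sum_erase _ _ (Finset.mem_univ v)]
      simp

/-- The same cut at the first arrival, where the clock restarts at `M`. Index `ij.1` means length
`ij.1 + 1`, so `ij.1 < t` says that the arrival is in time. -/
theorem clockCount_succ_eq_sum_antidiagonal (M p t : ℕ) (a : V) :
    clockCount A v M (p + 1) t a = ∑ ij ∈ Finset.HasAntidiagonal.antidiagonal p,
      (if ij.1 < t then firstPassageCount A v ij.1 a else 0) * clockCount A v M ij.2 M v := by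
  classical
  induction p generalizing a t with
  | zero =>
    cases t with
    | zero => simp [clockCount]
    | succ t =>
      simp only [clockCount, firstPassageCount, Finset.Nat.antidiagonal_zero, Finset.sum_singleton]
      rw [Finset.sum_eq_single v] <;> simp +contextual
  | succ p ih =>
    cases t with
    | zero => simp [clockCount]
    | succ t =>
    rw [Finset.Nat.sum_antidiagonal_succ]
    simp only [firstPassageCount]
    rw [clockCount, ← Finset.add_sum_erase _ _ (Finset.mem_univ v)]
    congr 1
    · simp
    · have : ∀ b ∈ Finset.univ.erase v,
          (if A a b then clockCount A v M (p + 1) (if b = v then M else t) b else 0) =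
          ∑ ij ∈ Finset.HasAntidiagonal.antidiagonal p, (if ij.1 < t then (if A a b ∧ b ≠ v then
            firstPassageCount A v ij.1 b else 0) else 0) * clockCount A v M ij.2 M v := by
        intro b hb
        have hb : b ≠ v := by simpa using hb
        by_cases h : A a b <;> simp [h, hb, ih]
      rw [Finset.sum_congr rfl this, Finset.sum_comm]
      refine Finset.sum_congr rfl fun ij _ => ?_
      rw [← Finset.sum_mul, ← Finset.add_sum_erase (a := v) Finset.univ
        (fun b => if A a b ∧ b ≠ v then firstPassageCount A v ij.1 b else 0) (Finset.mem_univ v)]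
      by_cases h : ij.1 < t <;> simp [h]

/-- A clock that cannot run out imposes nothing. Thus the comparison of counts with actual closed
paths is needed only for the clocked version. -/
theorem clockCount_eq_walkCount {M p t : ℕ} (hM : p ≤ M) (ht : p ≤ t) (a : V) :
    clockCount A v M p t a = walkCount A v p a := by
  classical
  induction p generalizing a t with
  | zero => simp [clockCount, walkCount]
  | succ p ih =>
    obtain ⟨t, rfl⟩ : ∃ s, t = s + 1 := ⟨t - 1, by omega⟩
    rw [clockCount, walkCount]
    refine Finset.sum_congr rfl fun b _ => ?_
    rw [ih (by omega) (by split_ifs <;> omega)]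

theorem apply_zero_of_mem_clockPaths {M p t : ℕ} {a : V} {γ : Fin (p + 1) → V}
    (h : γ ∈ clockPaths A v M p t a) : γ 0 = a := by
  classical
  match p, t with
  | 0, t =>
    by_cases ha : a = v <;> simp_all [clockPaths]
  | p + 1, 0 => simp [clockPaths] at h
  | p + 1, t + 1 =>
    simp only [clockPaths, Finset.mem_biUnion, Finset.mem_image] at h
    obtain ⟨b, -, γ', -, rfl⟩ := h
    rfl

theorem card_clockPaths (M p t : ℕ) (a : V) :
    (clockPaths A v M p t a).card = clockCount A v M p t a := by
  classical
  induction p generalizing a t with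
  | zero =>
    by_cases ha : a = v <;> simp_all [clockPaths, clockCount]
  | succ p ih =>
    cases t with
    | zero => simp [clockPaths, clockCount]
    | succ t =>
      rw [clockPaths, clockCount, Finset.card_biUnion, ← Finset.sum_filter]
      · refine Finset.sum_congr rfl fun b _ => ?_
        rw [Finset.card_image_of_injective _ (Fin.cons_right_injective (α := fun _ => V) a), ih]
      · intro b _ c _ hbc
        rw [Function.onFun, Finset.disjoint_left]
        intro γ hb hc
        simp only [Finset.mem_image] at hb hc
        obtain ⟨γ₁, h₁, rfl⟩ := hb
        obtain ⟨γ₂, h₂, h⟩ := hc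
        obtain rfl := Fin.cons_right_injective (α := fun _ => V) a h
        exact hbc ((apply_zero_of_mem_clockPaths h₁).symm.trans (apply_zero_of_mem_clockPaths h₂))

/-- The first arrival and the later returns have separate bounds because the induction strips the
first vertex: a return starting at the new initial vertex becomes a first arrival. -/
theorem clockPaths_spec {M p t : ℕ} {a : V} {γ : Fin (p + 1) → V}
    (h : γ ∈ clockPaths A v M p t a) :
    γ (Fin.last p) = v ∧ (∀ i : Fin p, A (γ i.castSucc) (γ i.succ)) ∧
    (∀ j : Fin (p + 1), 0 < j → γ j = v → (∀ k, 0 < k → k < j → γ k ≠ v) → (j : ℕ) ≤ t) ∧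
    (∀ i j : Fin (p + 1), 0 < i → i < j → γ i = v → γ j = v → (∀ k, i < k → k < j → γ k ≠ v) →
      (j : ℕ) - (i : ℕ) ≤ M) := by
  classical
  induction p generalizing a t with
  | zero =>
    by_cases ha : a = v
    · subst ha
      simp only [clockPaths, if_true, Finset.mem_singleton] at h
      subst h
      refine ⟨rfl, fun i => i.elim0, fun j hj => ?_, fun i j hi => ?_⟩
      · exact absurd hj (by simp [Fin.fin_one_eq_zero j])
      · exact absurd hi (by simp [Fin.fin_one_eq_zero i])
    · simp [clockPaths, ha] at h
  | succ p ih =>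
    cases t with
    | zero => simp [clockPaths] at h
    | succ t =>
      simp only [clockPaths, Finset.mem_biUnion, Finset.mem_image, Finset.mem_filter,
        Finset.mem_univ, true_and] at h
      obtain ⟨b, hab, γ', hγ', rfl⟩ := h
      obtain ⟨h1, h2, h3, h4⟩ := ih hγ'
      have h0 := apply_zero_of_mem_clockPaths hγ'
      refine ⟨?_, ?_, ?_, ?_⟩
      · rw [← Fin.succ_last, Fin.cons_succ, h1]
      · intro i
        refine Fin.cases ?_ (fun i => ?_) i
        · simpa [h0] using hab
        · rw [← Fin.succ_castSucc, Fin.cons_succ, Fin.cons_succ]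
          exact h2 i
      · intro j
        refine Fin.cases (fun h => absurd h (lt_irrefl _)) (fun j => ?_) j
        intro _ hj hk
        rw [Fin.cons_succ] at hj
        rcases Fin.eq_zero_or_eq_succ j with rfl | ⟨j', rfl⟩
        · simp
        · have hbv : b ≠ v := by
            have := hk (Fin.succ 0) (Fin.succ_pos _) (Fin.succ_lt_succ_iff.2 (Fin.succ_pos _))
            rwa [Fin.cons_succ, h0] at this
          have := h3 j'.succ (Fin.succ_pos _) hj fun k hk0 hkj => by
            have := hk k.succ (Fin.succ_pos _) (Fin.succ_lt_succ_iff.2 hkj)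
            rwa [Fin.cons_succ] at this
          rw [if_neg hbv] at this
          simp only [Fin.val_succ] at this ⊢
          omega
      · intro i
        refine Fin.cases (fun j h => absurd h (lt_irrefl _)) (fun i => ?_) i
        intro j
        refine Fin.cases (fun _ h => absurd h (Fin.not_lt_zero _)) (fun j => ?_) j
        intro _ hij hi hj hk
        rw [Fin.cons_succ] at hi hj
        have hk' : ∀ k, i < k → k < j → γ' k ≠ v := fun k hik hkj => by
          have := hk k.succ (Fin.succ_lt_succ_iff.2 hik) (Fin.succ_lt_succ_iff.2 hkj)
          rwa [Fin.cons_succ] at this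
        rw [Fin.succ_lt_succ_iff] at hij
        -- If the return starts right after the first step, that step has just reset the clock to
        -- `M`.
        rcases Fin.eq_zero_or_eq_succ i with rfl | ⟨i', rfl⟩
        · have hbv : b = v := h0.symm.trans hi
          have := h3 j hij hj hk'
          rw [if_pos hbv] at this
          simpa using this
        · have := h4 _ j (Fin.succ_pos _) hij hi hj hk'
          simp only [Fin.val_succ] at this ⊢
          omega

theorem walkCount_le_walkCount_succ {a b : V} (h : A a b) (p : ℕ) :
    walkCount A v p b ≤ walkCount A v (p + 1) a := by
  classical
  rw [walkCount]
  refine le_trans ?_ (Finset.single_le_sum (fun _ _ => Nat.zero_le _) (Finset.mem_univ b))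
  simp [h]

theorem exists_walkCount_le_walkCount_add {a b : V} (h : Relation.ReflTransGen A a b) :
    ∃ m, ∀ p, walkCount A v p b ≤ walkCount A v (p + m) a := by
  induction h using Relation.ReflTransGen.head_induction_on with
  | refl => exact ⟨0, fun p => le_rfl⟩
  | head h _ ih =>
    obtain ⟨m, hm⟩ := ih
    exact ⟨m + 1, fun p => (hm p).trans (walkCount_le_walkCount_succ h (p + m))⟩

theorem walkCount_zero_self : walkCount A v 0 v = 1 := by
  simp [walkCount]

end WalkCounting

/-! ### Counts versus sets of closed paths -/

namespace OrientedGraph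

variable {E : Type*}

/-- Adjacency on the vertices of a graph. -/
def vertAdj (G : OrientedGraph E) (a b : G.verts) : Prop := G.Adj a b

theorem clockCount_le_encard_closedPathsLE (G : OrientedGraph E) [Fintype G.verts] (v : G.verts)
    (p M : ℕ) :
    (clockCount G.vertAdj v M p M v : ℕ∞) ≤ (G.closedPathsLE (v : E) p M).encard := by
  have hinj : Function.Injective
      (fun (γ : Fin (p + 1) → G.verts) (i : Fin (p + 1)) => (γ i : E)) := fun γ₁ γ₂ h =>
    funext fun i => Subtype.ext (congrFun h i)
  rw [← card_clockPaths, ← Set.encard_coe_eq_coe_finsetCard, ← hinj.encard_image]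
  refine Set.encard_le_encard ?_
  rintro _ ⟨γ, hγ, rfl⟩
  have h0 := apply_zero_of_mem_clockPaths hγ
  obtain ⟨h1, h2, h3, h4⟩ := clockPaths_spec hγ
  refine ⟨⟨by simp [h0], by simp [h1], fun i => (γ i).2, h2⟩, fun i j hij hi hj hk => ?_⟩
  have hk' : ∀ k, i < k → k < j → γ k ≠ v := fun k hik hkj h => hk k hik hkj (by simp [h])
  rcases Fin.eq_zero_or_eq_succ i with rfl | ⟨i, rfl⟩
  · simpa using h3 j hij (Subtype.ext hj) hk'
  · exact h4 _ j (Fin.succ_pos _) hij (Subtype.ext hi) (Subtype.ext hj) hk'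

theorem walkCount_le_encard_closedPaths (G : OrientedGraph E) [Fintype G.verts] (v : G.verts)
    (p : ℕ) : (walkCount G.vertAdj v p v : ℕ∞) ≤ (G.closedPaths (v : E) p).encard := by
  rw [← clockCount_eq_walkCount (M := p) (t := p) le_rfl le_rfl]
  exact (G.clockCount_le_encard_closedPathsLE v p p).trans
    (Set.encard_le_encard fun γ h => h.1)

theorem closedPathsLE_mono {G' G : OrientedGraph E} (h : G'.IsSubgraph G) (u : E) (p M : ℕ) :
    G'.closedPathsLE u p M ⊆ G.closedPathsLE u p M := fun _ hγ =>
  ⟨⟨hγ.1.1, hγ.1.2.1, fun i => h.1 (hγ.1.2.2.1 i), fun i => h.2 _ _ (hγ.1.2.2.2 i)⟩, hγ.2⟩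

end OrientedGraph

/-! ### Renewal sequences -/

section Renewal

/-- The generating functions of a renewal sequence satisfy the renewal equation. -/
theorem renewal_tsum {f N : ℕ → ℝ} (hf : ∀ i, 0 ≤ f i) (hN : ∀ i, 0 ≤ N i) (h0 : N 0 = 1)
    (hrec : ∀ p, N (p + 1) = ∑ ij ∈ Finset.HasAntidiagonal.antidiagonal p, f ij.1 * N ij.2) {z : ℝ} (hz : 0 < z)
    (hs : Summable fun p => N p * z ^ p) :
    (Summable fun i => f i * z ^ (i + 1)) ∧
    (∑' p, N p * z ^ p) = 1 + (∑' i, f i * z ^ (i + 1)) * ∑' p, N p * z ^ p := by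
  have hs1 : Summable fun p => N (p + 1) * z ^ (p + 1) := (summable_nat_add_iff 1).2 hs
  -- The term `(p, 0)` of the recursion dominates `f`, so its series converges wherever that of `N`
  -- does.
  have hfN : ∀ p, f p ≤ N (p + 1) := fun p => by
    rw [hrec]
    refine le_trans ?_ (Finset.single_le_sum (fun ij _ => mul_nonneg (hf ij.1) (hN ij.2))
      (Finset.HasAntidiagonal.mem_antidiagonal.2 (by simp) :
        (p, 0) ∈ Finset.HasAntidiagonal.antidiagonal p))
    simp [h0]
  have hsf : Summable fun i => f i * z ^ (i + 1) :=
    Summable.of_nonneg_of_le (fun i => mul_nonneg (hf i) (by positivity))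
      (fun i => mul_le_mul_of_nonneg_right (hfN i) (by positivity)) hs1
  refine ⟨hsf, ?_⟩
  rw [tsum_mul_tsum_eq_tsum_sum_antidiagonal_of_summable_norm hsf.norm hs.norm,
    hs.tsum_eq_zero_add, h0]
  simp only [pow_zero, mul_one]
  congr 1
  refine tsum_congr fun p => ?_
  rw [hrec, Finset.sum_mul]
  refine Finset.sum_congr rfl fun ij hij => ?_
  rw [← Finset.HasAntidiagonal.mem_antidiagonal.1 hij]
  ring

theorem summable_mul_pow_of_le_pow {N : ℕ → ℝ} (hN : ∀ i, 0 ≤ N i) {b z : ℝ} (hz : 0 < z)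
    (hb : 0 < b) (hle : ∀ p, N p ≤ b ^ p) (hzb : b * z < 1) : Summable fun p => N p * z ^ p := by
  refine Summable.of_nonneg_of_le (fun i => mul_nonneg (hN i) (by positivity)) (fun i => ?_)
    (summable_geometric_of_lt_one (by positivity) hzb)
  rw [mul_pow]
  exact mul_le_mul_of_nonneg_right (hle i) (by positivity)

/-- If a renewal sequence grows at most like `b ^ p`, the generating function of the first returns
is at most one at `b⁻¹`. -/
theorem renewal_sum_le_one {f N : ℕ → ℝ} (hf : ∀ i, 0 ≤ f i) (hN : ∀ i, 0 ≤ N i) (h0 : N 0 = 1)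
    (hrec : ∀ p, N (p + 1) = ∑ ij ∈ Finset.HasAntidiagonal.antidiagonal p, f ij.1 * N ij.2) {b : ℝ} (hb : 0 < b)
    (hle : ∀ p, N p ≤ b ^ p) (s : Finset ℕ) : ∑ i ∈ s, f i * b⁻¹ ^ (i + 1) ≤ 1 := by
  -- At `b⁻¹` itself the series of `N` may diverge, so the bound is proved for smaller `z` and
  -- passed to the limit on finite sums.
  have hcont : Tendsto (fun z : ℝ => ∑ i ∈ s, f i * z ^ (i + 1)) (𝓝[<] b⁻¹)
      (𝓝 (∑ i ∈ s, f i * b⁻¹ ^ (i + 1))) :=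
    (Continuous.tendsto (by fun_prop) _).mono_left nhdsWithin_le_nhds
  refine le_of_tendsto hcont ?_
  filter_upwards [Ioo_mem_nhdsLT (inv_pos.2 hb)] with z hz
  have hzb : b * z < 1 := by
    have := mul_lt_mul_of_pos_left hz.2 hb
    rwa [mul_inv_cancel₀ hb.ne'] at this
  have hs := summable_mul_pow_of_le_pow hN hz.1 hb hle hzb
  obtain ⟨hsf, heq⟩ := renewal_tsum hf hN h0 hrec hz.1 hs
  have hR : 0 ≤ ∑' p, N p * z ^ p := tsum_nonneg fun p => mul_nonneg (hN p) (pow_nonneg hz.1.le _)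
  have hR1 : 0 < ∑' p, N p * z ^ p := by
    have h := hs.le_tsum 0 fun p _ => mul_nonneg (hN p) (pow_nonneg hz.1.le _)
    simp only [h0, pow_zero, mul_one] at h
    linarith
  refine (hsf.sum_le_tsum s fun i _ => mul_nonneg (hf i) (pow_nonneg hz.1.le _)).trans ?_
  -- With R finite and positive, R = 1 + F R is impossible for F > 1.
  by_contra! hlt
  nlinarith

end Renewal

/-! ### Lower bounds for the entropy -/

section EntropyLowerBound

variable {α : Type*} [MeasurableSpace α]

/-- The average of a `T ^ p`-invariant probability measure along `T` is `T`-invariant. -/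
theorem exists_measurePreserving_average {T : α → α} (hT : Measurable T) (m : Measure α)
    [IsProbabilityMeasure m] {p : ℕ} (hp : 0 < p) (hm : m.map (T^[p]) = m) :
    ∃ ν : Measure α, IsProbabilityMeasure ν ∧ MeasurePreserving T ν ν ∧
      ∀ s, MeasurableSet s → ∀ c, (∀ j < p, m (T^[j] ⁻¹' s) ≤ c) → ν s ≤ c := by
  have hp0 : (p : ENNReal) ≠ 0 := by simpa using hp.ne'
  have hcancel : (p : ENNReal)⁻¹ * p = 1 := ENNReal.inv_mul_cancel hp0 (ENNReal.natCast_ne_top p)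
  set ν : Measure α := (p : ENNReal)⁻¹ • ∑ j ∈ Finset.range p, m.map (T^[j]) with hν
  have happ : ∀ s, MeasurableSet s →
      ν s = (p : ENNReal)⁻¹ * ∑ j ∈ Finset.range p, m (T^[j] ⁻¹' s) := by
    intro s hs
    simp only [hν, Measure.smul_apply, Measure.finsetSum_apply, smul_eq_mul]
    congr 1
    exact Finset.sum_congr rfl fun j _ => Measure.map_apply (hT.iterate j) hs
  refine ⟨ν, ⟨?_⟩, ⟨hT, ?_⟩, ?_⟩
  · rw [happ _ MeasurableSet.univ]
    simp [hcancel]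
  · ext s hs
    rw [Measure.map_apply hT hs, happ _ (hT hs), happ _ hs]
    congr 1
    have h1 : ∀ j, m (T^[j] ⁻¹' (T ⁻¹' s)) = m (T^[j + 1] ⁻¹' s) := fun j => by
      rw [← preimage_comp, ← Function.iterate_succ']
    -- Applying `T` permutes the `p` summands cyclically.
    have h2 : m (T^[p] ⁻¹' s) = m (T^[0] ⁻¹' s) := by
      rw [← Measure.map_apply (hT.iterate p) hs, hm]; rfl
    obtain ⟨q, rfl⟩ : ∃ q, p = q + 1 := ⟨p - 1, by omega⟩
    rw [Finset.sum_congr rfl fun j _ => h1 j, Finset.sum_range_succ, Finset.sum_range_succ', h2]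
  · intro s hs c hc
    rw [happ s hs]
    calc (p : ENNReal)⁻¹ * ∑ j ∈ Finset.range p, m (T^[j] ⁻¹' s)
        ≤ (p : ENNReal)⁻¹ * ∑ j ∈ Finset.range p, c := by
          gcongr with j hj
          exact hc j (Finset.mem_range.1 hj)
      _ = c := by
          rw [Finset.sum_const, Finset.card_range, nsmul_eq_mul, ← mul_assoc, hcancel, one_mul]

theorem measurable_label {T : α → α} (hT : Measurable T) {k : ℕ} {P : α → Fin k}
    (hP : Measurable P) (n : ℕ) : Measurable fun x (i : Fin n) => P (T^[i] x) :=
  measurable_pi_lambda _ fun i => hP.comp (hT.iterate i)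

theorem setOf_label_eq {α : Type*} (T : α → α) {k : ℕ} (P : α → Fin k) {n : ℕ} (w : Fin n → Fin k) :
    {x | ∀ i : Fin n, P (T^[i] x) = w i} = (fun x (i : Fin n) => P (T^[i] x)) ⁻¹' {w} := by
  ext x
  simp [funext_iff]

/-- Shannon entropy is the mean of the information -log μ(w), and each atom of positive mass carries
at least -log c. -/
theorem neg_log_le_joinEntropy {T : α → α} (hT : Measurable T) (μ : Measure α)
    [IsProbabilityMeasure μ] {k : ℕ} {P : α → Fin k} (hP : Measurable P) (n : ℕ) {c : ℝ}
    (hc : ∀ w : Fin n → Fin k, μ.real {x | ∀ i : Fin n, P (T^[i] x) = w i} ≤ c) :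
    -Real.log c ≤ joinEntropy T μ P n := by
  have hsum : ∑ w : Fin n → Fin k, μ.real {x | ∀ i : Fin n, P (T^[i] x) = w i} = 1 := by
    simp_rw [setOf_label_eq]
    rw [sum_measureReal_preimage_singleton _
      fun w _ => measurable_label hT hP n (MeasurableSet.singleton w)]
    simp
  calc -Real.log c = ∑ w : Fin n → Fin k,
        μ.real {x | ∀ i : Fin n, P (T^[i] x) = w i} * (-Real.log c) := by
        rw [← Finset.sum_mul, hsum, one_mul]
    _ ≤ _ := by
        refine Finset.sum_le_sum fun w _ => ?_
        rcases (measureReal_nonneg (μ := μ)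
          (s := {x | ∀ i : Fin n, P (T^[i] x) = w i})).eq_or_lt with h | h
        · simp [← h]
        · rw [Real.negMulLog, neg_mul, mul_neg]
          exact neg_le_neg (mul_le_mul_of_nonneg_left (Real.log_le_log h (hc w)) h.le)

/-- If the words of length `n` have measure at most `N ^ (-(n / p - 1))`, the entropy is at least
`log N / p`. -/
theorem log_div_le_ksEntropy {T : α → α} (hT : Measurable T) (μ : Measure α)
    [IsProbabilityMeasure μ] {k : ℕ} {P : α → Fin k} (hP : Measurable P) {N p : ℕ}
    (hp : 0 < p) (hc : ∀ n, ∀ w : Fin n → Fin k,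
      μ.real {x | ∀ i : Fin n, P (T^[i] x) = w i} ≤ ((N : ℝ)⁻¹) ^ (n / p - 1)) :
    ((Real.log N / p : ℝ) : EReal) ≤ ksEntropy T μ := by
  refine le_trans ?_ (le_iSup_of_le k (le_iSup_of_le P (le_iSup_of_le hP le_rfl)))
  have hlog : 0 ≤ Real.log N := Real.log_natCast_nonneg N
  have hlim : Tendsto (fun n : ℕ => ((Real.log N / p - 2 * Real.log N / n : ℝ) : EReal)) atTop
      (𝓝 ((Real.log N / p : ℝ) : EReal)) := by
    refine (continuous_coe_real_ereal.tendsto _).comp ?_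
    have h : Tendsto (fun n : ℕ => 2 * Real.log N / (n : ℝ)) atTop (𝓝 0) :=
      tendsto_const_div_atTop_nhds_zero_nat _
    simpa using tendsto_const_nhds.sub h
  rw [← hlim.limsup_eq, partitionEntropy]
  refine limsup_le_limsup ?_
  filter_upwards [eventually_gt_atTop 0] with n hn
  rw [EReal.coe_le_coe_iff]
  have h := neg_log_le_joinEntropy hT μ hP n (hc n)
  rw [Real.log_pow, Real.log_inv, mul_neg, neg_neg] at h
  have hn' : (0 : ℝ) < n := by exact_mod_cast hn
  have hp' : (0 : ℝ) < p := by exact_mod_cast hp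
  -- One unit is lost to the integer division and one to the incomplete first block.
  have hq : (n : ℝ) / p - 2 ≤ ((n / p - 1 : ℕ) : ℝ) := by
    have h1 : n < p * (n / p + 1) := Nat.lt_mul_div_succ n hp
    have h2 : n / p ≤ (n / p - 1) + 1 := by omega
    have h3 : (n : ℝ) / p < ((n / p : ℕ) : ℝ) + 1 := by
      rw [div_lt_iff₀ hp']
      have : (n : ℝ) < (p : ℝ) * (((n / p : ℕ) : ℝ) + 1) := by exact_mod_cast h1
      linarith
    have h4 : ((n / p : ℕ) : ℝ) ≤ ((n / p - 1 : ℕ) : ℝ) + 1 := by exact_mod_cast h2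
    linarith
  rw [le_div_iff₀ hn']
  calc (Real.log N / p - 2 * Real.log N / n) * n = ((n : ℝ) / p - 2) * Real.log N := by
        field_simp
    _ ≤ _ := (mul_le_mul_of_nonneg_right hq hlog).trans h

end EntropyLowerBound

/-! ### Entropy produced by random concatenation of loops -/

namespace OrientedGraph

variable {W : Type*}

theorem measurable_coord (K : OrientedGraph W) {β : Type*} [MeasurableSpace β] (f : K.verts → β)
    (n : ℤ) : Measurable fun x : K.ShiftSpace => f (x.1 n) := by
  let : MeasurableSpace K.verts := ⊤
  have h1 : Measurable f := measurable_from_top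
  have h2 : Measurable (fun x : K.ShiftSpace => x.1 n) :=
    (measurable_pi_apply n).comp measurable_subtype_coe
  exact h1.comp h2

theorem measurable_of_coords (K : OrientedGraph W) {α : Type*} [MeasurableSpace α]
    {f : α → K.ShiftSpace} (h : ∀ n, @Measurable _ _ _ ⊤ fun a => (f a).1 n) : Measurable f := by
  let : MeasurableSpace K.verts := ⊤
  have h1 : Measurable fun a => (f a).1 := measurable_pi_lambda _ h
  exact h1.subtype_mk (h := fun a => (f a).2)

theorem measurable_shift (K : OrientedGraph W) : Measurable K.shift :=
  K.measurable_of_coords fun n => @measurable_coord W K K.verts ⊤ id (n + 1)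

theorem shift_iterate_apply (K : OrientedGraph W) (j : ℕ) (x : K.ShiftSpace) (n : ℤ) :
    (K.shift^[j] x).1 n = x.1 (n + j) := by
  induction j generalizing x with
  | zero => simp
  | succ j ih =>
    rw [Function.iterate_succ_apply, ih]
    show x.1 (n + j + 1) = _
    push_cast
    ring_nf

/-- The bi-infinite path obtained by concatenating closed paths of length `p` at `u`. -/
def concatLoops (K : OrientedGraph W) {u : W} {p : ℕ} (hp : 0 < p) {S : Finset (Fin (p + 1) → W)}
    (hS : ∀ γ ∈ S, γ ∈ K.closedPaths u p) (ω : ℤ → S) : K.ShiftSpace :=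
  ⟨fun n => ⟨(ω (n / p)).1 ⟨(n % p).toNat, by
      have := Int.emod_lt_of_pos n (Int.natCast_pos.2 hp); omega⟩,
    (hS _ (ω (n / p)).2).2.2.1 _⟩, by
    intro n
    obtain ⟨q, t, ht, rfl⟩ : ∃ (q : ℤ) (t : ℕ), t < p ∧ n = t + q * p := by
      have h1 := Int.emod_lt_of_pos n (Int.natCast_pos.2 hp)
      have h2 := Int.emod_nonneg n (Int.natCast_ne_zero.2 hp.ne')
      refine ⟨n / p, (n % p).toNat, by omega, ?_⟩
      rw [Int.toNat_of_nonneg h2, mul_comm]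
      exact (Int.emod_add_mul_ediv n p).symm
    have hp' : (p : ℤ) ≠ 0 := Int.natCast_ne_zero.2 hp.ne'
    have e1 : ((t : ℤ) + q * p) / p = q := by
      rw [Int.add_mul_ediv_right _ _ hp', Int.ediv_eq_zero_of_lt (by omega) (by omega), zero_add]
    have e2 : ((t : ℤ) + q * p) % p = t := by
      rw [Int.add_mul_emod_self_right, Int.emod_eq_of_lt (by omega) (by omega)]
    have hadj := (hS _ (ω q).2).2.2.2 ⟨t, ht⟩
    by_cases h : t + 1 < p
    · have e3 : ((t : ℤ) + q * p + 1) / p = q := by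
        rw [add_right_comm, Int.add_mul_ediv_right _ _ hp',
          Int.ediv_eq_zero_of_lt (by omega) (by omega), zero_add]
      have e4 : ((t : ℤ) + q * p + 1) % p = t + 1 := by
        rw [add_right_comm, Int.add_mul_emod_self_right, Int.emod_eq_of_lt (by omega) (by omega)]
      simp only [e1, e2, e3, e4]
      exact hadj
    -- At a junction, the arrow into the endpoint `u` of one loop is the arrow into the start of the
    -- next.
    · have htp : t + 1 = p := by omega
      have e0 : (t : ℤ) + q * p + 1 = (q + 1) * p := by
        rw [add_right_comm, add_mul, one_mul, add_comm]; congr 1; exact_mod_cast htp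
      have e3 : ((t : ℤ) + q * p + 1) / p = q + 1 := by
        rw [e0, Int.mul_ediv_cancel _ hp']
      have e4 : ((t : ℤ) + q * p + 1) % p = 0 := by
        rw [e0, Int.mul_emod_left]
      simp only [e1, e2, e3, e4]
      have hlast : (⟨t, ht⟩ : Fin p).succ = Fin.last p := Fin.ext htp
      rw [hlast, (hS _ (ω q).2).2.1] at hadj
      have h0 := (hS _ (ω (q + 1)).2).1
      have h0' : (ω (q + 1)).1 ⟨Int.toNat 0, by simp⟩ = u := h0
      rw [h0']
      exact hadj⟩

section ConcatLoops

variable (K : OrientedGraph W) {u : W} {p : ℕ} (hp : 0 < p) {S : Finset (Fin (p + 1) → W)}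
  (hS : ∀ γ ∈ S, γ ∈ K.closedPaths u p)

theorem concatLoops_apply (ω : ℤ → S) (q : ℤ) {t : ℕ} (ht : t < p) :
    (((K.concatLoops hp hS ω).1 (t + q * p) : K.verts) : W) = (ω q).1 ⟨t, by omega⟩ := by
  have hp' : (p : ℤ) ≠ 0 := Int.natCast_ne_zero.2 hp.ne'
  have e1 : ((t : ℤ) + q * p) / p = q := by
    rw [Int.add_mul_ediv_right _ _ hp', Int.ediv_eq_zero_of_lt (by omega) (by omega), zero_add]
  have e2 : ((t : ℤ) + q * p) % p = t := by
    rw [Int.add_mul_emod_self_right, Int.emod_eq_of_lt (by omega) (by omega)]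
  simp only [concatLoops, e1, e2]
  rfl

theorem shift_iterate_concatLoops (ω : ℤ → S) :
    K.shift^[p] (K.concatLoops hp hS ω) = K.concatLoops hp hS fun b => ω (b + 1) := by
  refine Subtype.ext (funext fun n => Subtype.ext ?_)
  rw [shift_iterate_apply]
  have hp' : (p : ℤ) ≠ 0 := Int.natCast_ne_zero.2 hp.ne'
  have e1 : (n + p) / p = n / p + 1 := by
    simpa using Int.add_mul_ediv_right n 1 hp'
  simp only [concatLoops, e1, Int.add_emod_right]

theorem measurable_concatLoops [MeasurableSpace S] (hM : ∀ s : Set S, MeasurableSet s) :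
    Measurable (K.concatLoops hp hS) := by
  refine K.measurable_of_coords fun n => ?_
  let : MeasurableSpace K.verts := ⊤
  have h : Measurable fun γ : S => (⟨γ.1 ⟨(n % p).toNat, by
      have := Int.emod_lt_of_pos n (Int.natCast_pos.2 hp); omega⟩,
    (hS _ γ.2).2.2.1 _⟩ : K.verts) := fun s _ => hM _
  exact h.comp (measurable_pi_apply (n / p))

end ConcatLoops

/-- Some map to a finite type is injective on a given finite set. -/
theorem exists_label_injOn (B : Finset W) : ∃ (k : ℕ) (e : W → Fin k), Set.InjOn e B := by
  classical
  refine ⟨B.card + 1, fun x => if h : x ∈ B then (B.equivFin ⟨x, h⟩).castSucc else Fin.last _, ?_⟩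
  intro x hx y hy h
  have hx : x ∈ B := hx
  have hy : y ∈ B := hy
  simpa [hx, hy] using h

/-- The closed paths of a given length at a vertex bound the entropy from below. -/
theorem log_card_div_le_entropy (K : OrientedGraph W) {u : W} {p : ℕ} (hp : 0 < p)
    {S : Finset (Fin (p + 1) → W)} (hne : S.Nonempty) (hS : ∀ γ ∈ S, γ ∈ K.closedPaths u p) :
    ((Real.log S.card / p : ℝ) : EReal) ≤ K.entropy := by
  classical
  let : MeasurableSpace S := ⊤
  have hM : ∀ s : Set S, MeasurableSet s := fun s => trivial
  have : Nonempty S := hne.to_subtype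
  -- Loops are drawn independently and uniformly. The image measure is invariant under the `p`-th
  -- power of the shift only, hence the averaging below.
  let P : Measure (ℤ → S) := Measure.infinitePi fun _ => (PMF.uniformOfFintype S).toMeasure
  have hc := K.measurable_concatLoops hp hS hM
  let m : Measure K.ShiftSpace := P.map (K.concatLoops hp hS)
  have : IsProbabilityMeasure m := Measure.isProbabilityMeasure_map hc.aemeasurable
  have hP : P.map (fun (ω : ℤ → S) b => ω (b + 1)) = P :=
    Measure.map_infinitePi_infinitePi_of_inj (add_left_injective (1 : ℤ))
  have hm : m.map (K.shift^[p]) = m := by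
    have hsh : Measurable fun (ω : ℤ → S) (b : ℤ) => ω (b + 1) :=
      measurable_pi_lambda _ fun b => measurable_pi_apply (b + 1)
    calc m.map (K.shift^[p]) = P.map (K.shift^[p] ∘ K.concatLoops hp hS) :=
          Measure.map_map (K.measurable_shift.iterate p) hc
      _ = P.map (K.concatLoops hp hS ∘ fun (ω : ℤ → S) b => ω (b + 1)) := by
          congr 1
          funext ω
          exact K.shift_iterate_concatLoops hp hS ω
      _ = m := by rw [← Measure.map_map hc hsh, hP]
  obtain ⟨ν, hν, hinv, hle⟩ := exists_measurePreserving_average K.measurable_shift m hp hm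
  obtain ⟨k, e, he⟩ := exists_label_injOn (S.biUnion fun γ => Finset.univ.image γ)
  let Q : K.ShiftSpace → Fin k := fun x => e (x.1 0)
  have hQ : Measurable Q := K.measurable_coord (fun a => e a) 0
  refine (log_div_le_ksEntropy K.measurable_shift ν hQ hp fun n w => ?_).trans
    (le_iSup₂_of_le ν ⟨hν, hinv⟩ le_rfl)
  have hmeas : MeasurableSet {x | ∀ i : Fin n, Q (K.shift^[i] x) = w i} := by
    rw [setOf_label_eq]
    exact measurable_label K.measurable_shift hQ n (MeasurableSet.singleton w)
  have hbound : ν {x | ∀ i : Fin n, Q (K.shift^[i] x) = w i} ≤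
      ((S.card : ENNReal)⁻¹) ^ (n / p - 1) := by
    refine hle _ hmeas _ fun j hj => ?_
    rw [Measure.map_apply hc (K.measurable_shift.iterate j hmeas)]
    -- The loops allowed in block `b` by the word `w` read from time `j`. For 1 ≤ b < n / p the
    -- whole block is visible whatever `j < p` is, so at most one loop is allowed.
    let t : ℤ → Set S := fun b => {γ | ∀ s (hs : s < p) (i : Fin n), (i : ℤ) + j = s + b * p →
      e (γ.1 ⟨s, by omega⟩) = w i}
    have hsub : K.concatLoops hp hS ⁻¹' (K.shift^[j] ⁻¹'
        {x | ∀ i : Fin n, Q (K.shift^[i] x) = w i}) ⊆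
        Set.pi (Finset.Ico (1 : ℤ) (n / p : ℕ)) t := by
      intro ω hω b _ s hs i hi
      have h := hω i
      simp only [Q, shift_iterate_apply] at h
      rw [zero_add, hi, K.concatLoops_apply hp hS ω b hs] at h
      exact h
    refine (measure_mono hsub).trans ?_
    rw [Measure.infinitePi_pi _ fun b _ => hM _]
    have hcard : (Finset.Ico (1 : ℤ) (n / p : ℕ)).card = n / p - 1 := by
      rw [Int.card_Ico]; omega
    rw [← hcard]
    refine Finset.prod_le_pow_card _ _ _ fun b hb => ?_
    rw [Finset.mem_Ico] at hb
    have hsubs : (t b).Subsingleton := by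
      intro γ₁ h₁ γ₂ h₂
      refine Subtype.ext (funext fun s => ?_)
      by_cases hs : (s : ℕ) < p
      · have hnp : ((n / p : ℕ) : ℤ) * p ≤ n := by exact_mod_cast Nat.div_mul_le_self n p
        have hb1 : (b + 1) * p ≤ ((n / p : ℕ) : ℤ) * p :=
          mul_le_mul_of_nonneg_right (by omega) (by omega)
        have hb2 : 1 * (p : ℤ) ≤ b * p := mul_le_mul_of_nonneg_right hb.1 (by omega)
        rw [add_mul] at hb1
        obtain ⟨i, hi⟩ : ∃ i : Fin n, (i : ℤ) + j = (s : ℕ) + b * p :=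
          ⟨⟨((s : ℕ) + b * p - j).toNat, by omega⟩, by simp only; omega⟩
        refine he ?_ ?_ ((h₁ s hs i hi).trans (h₂ s hs i hi).symm)
        · exact Finset.mem_coe.2 (Finset.mem_biUnion.2
            ⟨γ₁.1, γ₁.2, Finset.mem_image_of_mem _ (Finset.mem_univ _)⟩)
        · exact Finset.mem_coe.2 (Finset.mem_biUnion.2
            ⟨γ₂.1, γ₂.2, Finset.mem_image_of_mem _ (Finset.mem_univ _)⟩)
      -- The last vertex lies outside the block but is always `u`.
      · obtain rfl : s = Fin.last p := Fin.ext (by simp only [Fin.val_last]; omega)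
        rw [(hS _ γ₁.2).2.1, (hS _ γ₂.2).2.1]
    rcases hsubs.eq_empty_or_singleton with h | ⟨γ, h⟩
    · simp [h]
    · rw [h, PMF.toMeasure_apply_singleton _ _ (hM _), PMF.uniformOfFintype_apply,
        Fintype.card_coe]
  have := ENNReal.toReal_mono (by simp [hne.ne_empty]) hbound
  simpa [Measure.real] using this

/-- The number of closed paths of length `p` at a vertex is at most `exp (p * h)` if `h` bounds the
entropy. -/
theorem encard_closedPaths_le (K : OrientedGraph W) {u : W} {h : ℝ} (hK : K.entropy ≤ h) (p : ℕ)
    {N : ℕ} (hN : (N : ℕ∞) ≤ (K.closedPaths u p).encard) : (N : ℝ) ≤ Real.exp h ^ p := by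
  rcases Nat.eq_zero_or_pos p with rfl | hp
  · have hss : (K.closedPaths u 0).Subsingleton := fun γ₁ h₁ γ₂ h₂ => funext fun i => by
      rw [Fin.fin_one_eq_zero i, h₁.1, h₂.1]
    have : (N : ℕ∞) ≤ 1 := hN.trans (Set.encard_le_one_iff_subsingleton.2 hss)
    simpa using this
  rcases Nat.eq_zero_or_pos N with rfl | hN0
  · simp; positivity
  -- Taking `N` of the closed paths avoids assuming that their set is finite.
  obtain ⟨S, hS, hcard⟩ := Set.exists_subset_encard_eq hN
  have hfin : S.Finite := Set.finite_of_encard_eq_coe hcard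
  have hcard' : hfin.toFinset.card = N := by
    have := hfin.encard_eq_coe_toFinset_card
    rw [hcard] at this
    exact_mod_cast this.symm
  have hent := K.log_card_div_le_entropy hp (S := hfin.toFinset)
    (Finset.card_pos.1 (hcard'.symm ▸ hN0)) (fun γ hγ => hS (hfin.mem_toFinset.1 hγ))
  rw [hcard'] at hent
  have h1 := EReal.coe_le_coe_iff.1 (hent.trans hK)
  have hp' : (0 : ℝ) < p := by exact_mod_cast hp
  rw [div_le_iff₀ hp', Real.log_le_iff_le_exp (by exact_mod_cast hN0)] at h1
  rwa [← Real.exp_nat_mul, mul_comm]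

end OrientedGraph

/-! ### Upper bounds for the entropy -/

section Gibbs

/-- Gibbs' inequality. -/
theorem sum_negMulLog_le {κ : Type*} [Fintype κ] {p q : κ → ℝ} (hp : ∀ c, 0 ≤ p c)
    (hp1 : ∑ c, p c = 1) (hq : ∀ c, 0 ≤ q c) (hq1 : ∑ c, q c ≤ 1) (hpq : ∀ c, p c ≠ 0 → 0 < q c) :
    ∑ c, Real.negMulLog (p c) ≤ ∑ c, p c * -Real.log (q c) := by
  have key : ∀ c, Real.negMulLog (p c) ≤ p c * -Real.log (q c) + (q c - p c) := by
    intro c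
    rcases (hp c).eq_or_lt with h | h
    · simp [← h, hq c]
    · have hqc := hpq c h.ne'
      -- This is log x ≤ x - 1 at x = q/p; the errors q - p sum to at most 0.
      have h1 := Real.log_le_sub_one_of_pos (div_pos hqc h)
      rw [Real.log_div hqc.ne' h.ne'] at h1
      have h2 := mul_le_mul_of_nonneg_left h1 h.le
      have h3 : p c * (q c / p c - 1) = q c - p c := by field_simp
      rw [Real.negMulLog]
      nlinarith
  calc ∑ c, Real.negMulLog (p c) ≤ ∑ c, (p c * -Real.log (q c) + (q c - p c)) :=
        Finset.sum_le_sum fun c _ => key c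
    _ = ∑ c, p c * -Real.log (q c) + (∑ c, q c - ∑ c, p c) := by
        rw [Finset.sum_add_distrib, Finset.sum_sub_distrib]
    _ ≤ _ := by linarith

/-- Splitting an atom cannot decrease entropy, since each piece has smaller log than the whole. -/
theorem negMulLog_sum_le {κ : Type*} [Fintype κ] {p : κ → ℝ} (hp : ∀ c, 0 ≤ p c) :
    Real.negMulLog (∑ c, p c) ≤ ∑ c, Real.negMulLog (p c) := by
  rw [Real.negMulLog, neg_mul, Finset.sum_mul, ← Finset.sum_neg_distrib]
  refine Finset.sum_le_sum fun c _ => ?_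
  rw [Real.negMulLog, neg_mul]
  rcases (hp c).eq_or_lt with h | h
  · simp [← h]
  · exact neg_le_neg (mul_le_mul_of_nonneg_left
      (Real.log_le_log h (Finset.single_le_sum (fun c _ => hp c) (Finset.mem_univ c))) h.le)

variable {α : Type*} [MeasurableSpace α] {μ : Measure α} [IsProbabilityMeasure μ]

theorem integrable_comp_of_finite {κ : Type*} [Finite κ] [MeasurableSpace κ]
    [MeasurableSingletonClass κ] {Z : α → κ} (hZ : Measurable Z) (f : κ → ℝ) :
    Integrable (fun x => f (Z x)) μ :=
  Integrable.comp_measurable (g := f) Integrable.of_finite hZ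

theorem integral_comp_of_fintype {κ : Type*} [Fintype κ] [MeasurableSpace κ]
    [MeasurableSingletonClass κ] {Z : α → κ} (hZ : Measurable Z) (f : κ → ℝ) :
    ∫ x, f (Z x) ∂μ = ∑ c, μ.real (Z ⁻¹' {c}) * f c := by
  rw [← integral_map (f := f) hZ.aemeasurable (Measurable.of_discrete).aestronglyMeasurable,
    integral_fintype Integrable.of_finite]
  refine Finset.sum_congr rfl fun c _ => ?_
  rw [map_measureReal_apply hZ (MeasurableSet.singleton c), smul_eq_mul]

theorem sum_negMulLog_measureReal_le {κ : Type*} [Fintype κ] [MeasurableSpace κ]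
    [MeasurableSingletonClass κ] {Z : α → κ} (hZ : Measurable Z) {q : κ → ℝ} (hq : ∀ c, 0 ≤ q c)
    (hq1 : ∑ c, q c ≤ 1) (hpos : ∀ x, 0 < q (Z x)) :
    ∑ c, Real.negMulLog (μ.real (Z ⁻¹' {c})) ≤ ∫ x, -Real.log (q (Z x)) ∂μ := by
  rw [integral_comp_of_fintype hZ fun c => -Real.log (q c)]
  refine sum_negMulLog_le (fun c => measureReal_nonneg) ?_ hq hq1 fun c hc => ?_
  · rw [sum_measureReal_preimage_singleton _ fun c _ => hZ (MeasurableSet.singleton c)]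
    simp
  · have : (Z ⁻¹' {c}).Nonempty := by
      by_contra h
      exact hc (by simp [Set.not_nonempty_iff_eq_empty.1 h])
    obtain ⟨x, rfl⟩ := this
    exact hpos x

/-- The entropy of a process `Y` is bounded by a coding of an auxiliary variable `X` followed by a
coding of each `Y i` given a prediction by a function of `X`. -/
theorem sum_negMulLog_le_of_prediction {κ : Type*} [Fintype κ] [MeasurableSpace κ]
    [MeasurableSingletonClass κ] {n k : ℕ} {X : α → κ} (hX : Measurable X)
    {Y : α → Fin n → Fin k} (hY : Measurable Y) {q : κ → ℝ} (hq : ∀ c, 0 ≤ q c)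
    (hq1 : ∑ c, q c ≤ 1) (hpos : ∀ x, 0 < q (X x)) {ρ : Fin k → Fin k → ℝ}
    (hρ : ∀ a b, 0 < ρ a b) (hρ1 : ∀ b, ∑ a, ρ a b ≤ 1) (g : Fin n → κ → Fin k) :
    ∑ w, Real.negMulLog (μ.real (Y ⁻¹' {w})) ≤
      ∫ x, -Real.log (q (X x)) ∂μ + ∑ i, ∫ x, -Real.log (ρ (Y x i) (g i (X x))) ∂μ := by
  have hZ : Measurable fun x => (Y x, X x) := hY.prodMk hX
  -- A subprobability on pairs: code `X` by `q`, then each `Y i` by `ρ` given its prediction. Gibbs'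
  -- inequality applied to it splits into the two costs.
  set Q : (Fin n → Fin k) × κ → ℝ := fun c => q c.2 * ∏ i, ρ (c.1 i) (g i c.2) with hQ
  have hprod : ∀ c : (Fin n → Fin k) × κ, 0 < ∏ i, ρ (c.1 i) (g i c.2) := fun c =>
    Finset.prod_pos fun i _ => hρ _ _
  have hQ1 : ∑ c, Q c ≤ 1 := by
    rw [Fintype.sum_prod_type_right]
    refine le_trans (Finset.sum_le_sum fun c _ => ?_) hq1
    simp only [hQ]
    rw [← Finset.mul_sum]
    refine mul_le_of_le_one_right (hq c) ?_
    rw [← Fintype.prod_sum fun i a => ρ a (g i c)]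
    exact Finset.prod_le_one (fun i _ => Finset.sum_nonneg fun a _ => (hρ _ _).le)
      fun i _ => hρ1 _
  have h1 : ∑ w, Real.negMulLog (μ.real (Y ⁻¹' {w})) ≤
      ∑ c, Real.negMulLog (μ.real ((fun x => (Y x, X x)) ⁻¹' {c})) := by
    rw [Fintype.sum_prod_type]
    refine Finset.sum_le_sum fun w _ => ?_
    have : μ.real (Y ⁻¹' {w}) = ∑ c, μ.real ((fun x => (Y x, X x)) ⁻¹' {(w, c)}) := by
      rw [← measureReal_biUnion_finset]
      · congr 1
        ext x
        simp
      · intro c _ d _ hcd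
        rw [Function.onFun, Set.disjoint_left]
        rintro x hx hx'
        simp only [mem_preimage, mem_singleton_iff, Prod.mk.injEq] at hx hx'
        exact hcd (hx.2.symm.trans hx'.2)
      · exact fun c _ => hZ (MeasurableSet.singleton _)
    rw [this]
    exact negMulLog_sum_le fun c => measureReal_nonneg
  refine h1.trans ((sum_negMulLog_measureReal_le hZ (q := Q)
    (fun c => mul_nonneg (hq _) (hprod c).le) hQ1
    fun x => mul_pos (hpos x) (hprod (Y x, X x))).trans (le_of_eq ?_))
  rw [← integral_finsetSum _ fun i _ => integrable_comp_of_finite hZ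
      fun c => -Real.log (ρ (c.1 i) (g i c.2)),
    ← integral_add (integrable_comp_of_finite hX fun c => -Real.log (q c))
      (integrable_finsetSum _ fun i _ => integrable_comp_of_finite hZ
      fun c => -Real.log (ρ (c.1 i) (g i c.2)))]
  refine integral_congr_ae (Eventually.of_forall fun x => ?_)
  simp only [hQ]
  rw [Real.log_mul (hpos x).ne' (hprod (Y x, X x)).ne', Real.log_prod fun i _ => (hρ _ _).ne',
    neg_add, Finset.sum_neg_distrib]

end Gibbs

/-! ### Markov codes and approximate prediction -/

section MarkovWeight

/-- The weight of a word for a transition matrix `Q` and the uniform initial distribution. -/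
noncomputable def markovWeight {V : Type*} [Fintype V] (Q : V → V → ℝ) {N : ℕ}
    (w : Fin (N + 1) → V) : ℝ :=
  (Fintype.card V : ℝ)⁻¹ * ∏ l : Fin N, Q (w l.castSucc) (w l.succ)

variable {V : Type*} [Fintype V] {Q : V → V → ℝ}

theorem markovWeight_nonneg (hQ : ∀ a b, 0 ≤ Q a b) {N : ℕ} (w : Fin (N + 1) → V) :
    0 ≤ markovWeight Q w :=
  mul_nonneg (by positivity) (Finset.prod_nonneg fun _ _ => hQ _ _)

theorem sum_markovWeight_le_one (hQ : ∀ a b, 0 ≤ Q a b) (hQ1 : ∀ a, ∑ b, Q a b ≤ 1) (N : ℕ) :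
    ∑ w : Fin (N + 1) → V, markovWeight Q w ≤ 1 := by
  have h : ∑ w : Fin (N + 1) → V, ∏ l : Fin N, Q (w l.castSucc) (w l.succ) ≤ Fintype.card V := by
    induction N with
    | zero => simp
    | succ N ih =>
      refine le_trans ?_ ih
      -- Summing out the last letter uses the row bound of `Q`.
      rw [← (Fin.snocEquiv fun _ : Fin (N + 2) => V).sum_comp, Fintype.sum_prod_type_right]
      refine Finset.sum_le_sum fun w _ => ?_
      have : ∀ b : V, ∏ l : Fin (N + 1), Q
          ((Fin.snocEquiv fun _ : Fin (N + 2) => V) (b, w) l.castSucc)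
          ((Fin.snocEquiv fun _ : Fin (N + 2) => V) (b, w) l.succ) =
          (∏ l : Fin N, Q (w l.castSucc) (w l.succ)) * Q (w (Fin.last N)) b := by
        intro b
        rw [Fin.prod_univ_castSucc]
        simp only [Fin.snocEquiv_apply, Fin.snoc_castSucc, Fin.succ_last, Fin.snoc_last,
          Fin.succ_castSucc]
      rw [Finset.sum_congr rfl fun b _ => this b, ← Finset.mul_sum]
      exact mul_le_of_le_one_right (Finset.prod_nonneg fun _ _ => hQ _ _) (hQ1 _)
  simp only [markovWeight]
  rw [← Finset.mul_sum]
  calc (Fintype.card V : ℝ)⁻¹ * _ ≤ (Fintype.card V : ℝ)⁻¹ * Fintype.card V := by gcongr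
    _ ≤ 1 := inv_mul_le_one

theorem neg_log_markovWeight {N : ℕ} {w : Fin (N + 1) → V}
    (hw : ∀ l : Fin N, 0 < Q (w l.castSucc) (w l.succ)) :
    -Real.log (markovWeight Q w) =
      Real.log (Fintype.card V) + ∑ l : Fin N, -Real.log (Q (w l.castSucc) (w l.succ)) := by
  have : Nonempty V := ⟨w 0⟩
  have hcard : (Fintype.card V : ℝ)⁻¹ ≠ 0 := by simp
  rw [markovWeight, Real.log_mul hcard (Finset.prod_pos fun l _ => hw l).ne',
    Real.log_prod fun l _ => (hw l).ne', Real.log_inv, neg_add, neg_neg, Finset.sum_neg_distrib]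

end MarkovWeight

/-- A linear bound for the entropy of the joined partitions bounds the partition entropy. -/
theorem partitionEntropy_le_of_linear {α : Type*} [MeasurableSpace α] {T : α → α} {μ : Measure α}
    {k : ℕ} {P : α → Fin k} {c C : ℝ} (h : ∀ n : ℕ, joinEntropy T μ P n ≤ n * c + C) :
    partitionEntropy T μ P ≤ (c : EReal) := by
  have hlim : Tendsto (fun n : ℕ => ((c + C / n : ℝ) : EReal)) atTop (𝓝 (c : EReal)) := by
    refine (continuous_coe_real_ereal.tendsto _).comp ?_
    simpa using tendsto_const_nhds.add (tendsto_const_div_atTop_nhds_zero_nat C)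
  rw [← hlim.limsup_eq, partitionEntropy]
  refine limsup_le_limsup ?_
  filter_upwards [eventually_gt_atTop 0] with n hn
  have hn' : (0 : ℝ) < n := by exact_mod_cast hn
  rw [EReal.coe_le_coe_iff, div_le_iff₀ hn']
  refine (h n).trans (le_of_eq ?_)
  field_simp

/-- Give the predicted label mass e^{-ε} and spread the rest over all labels. Correct predictions
cost at most ε, wrong ones a bounded amount; the denominator `k + 1` also covers `k = 0`. -/
theorem exists_predictionKernel (k : ℕ) {ε : ℝ} (hε : 0 < ε) :
    ∃ (ρ : Fin k → Fin k → ℝ) (C : ℝ), 0 ≤ C ∧ (∀ a b, 0 < ρ a b) ∧ (∀ b, ∑ a, ρ a b ≤ 1) ∧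
      (∀ a, -Real.log (ρ a a) ≤ ε) ∧ ∀ a b, -Real.log (ρ a b) ≤ ε + C := by
  classical
  have h1 : 0 < 1 - Real.exp (-ε) := by simp [hε]
  set η := 1 - Real.exp (-ε) with hη
  have hη1 : 1 - η = Real.exp (-ε) := by ring
  refine ⟨fun a b => if a = b then 1 - η else η / (k + 1), |Real.log (η / (k + 1))|,
    abs_nonneg _, ?_, ?_, ?_, ?_⟩
  · intro a b
    simp only
    split_ifs
    · rw [hη1]; positivity
    · positivity
  · intro b
    calc ∑ a, (if a = b then 1 - η else η / (k + 1))
        ≤ ∑ a : Fin k, ((if a = b then 1 - η else 0) + η / (k + 1)) := by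
          refine Finset.sum_le_sum fun a _ => ?_
          have : 0 < η / (k + 1) := by positivity
          split_ifs <;> linarith
      _ = (1 - η) + k * (η / (k + 1)) := by simp [Finset.sum_add_distrib]
      _ ≤ 1 := by
          have : k * (η / (k + 1)) ≤ η := by
            rw [← mul_div_assoc, div_le_iff₀ (by positivity)]
            nlinarith
          linarith
  · intro a
    simp [hη1]
  · intro a b
    have h2 := neg_abs_le (Real.log (η / (k + 1)))
    simp only
    split_ifs
    · rw [hη1, Real.log_exp]
      linarith [abs_nonneg (Real.log (η / (k + 1)))]
    · linarith

/-! ### Finite windows and the variational upper bound -/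

namespace OrientedGraph

variable {E : Type*} (G : OrientedGraph E)

/-- The `N + 1` coordinates of a path from `-m` on. -/
def window (m N : ℕ) (x : G.ShiftSpace) (l : Fin (N + 1)) : G.verts := x.1 ((l : ℤ) - m)

theorem measurable_window (m N : ℕ) :
    @Measurable _ _ _ (@MeasurableSpace.pi _ _ fun _ => ⊤) (G.window m N) := by
  let : MeasurableSpace G.verts := ⊤
  exact measurable_pi_lambda _ fun l => G.measurable_coord id _

theorem integral_shift_iterate {G : OrientedGraph E} {μ : Measure G.ShiftSpace}
    (hμ : MeasurePreserving G.shift μ μ) (j : ℕ) {f : G.ShiftSpace → ℝ} (hf : Measurable f) :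
    ∫ x, f (G.shift^[j] x) ∂μ = ∫ x, f x ∂μ := by
  have h := hμ.iterate j
  rw [← integral_map h.measurable.aemeasurable hf.aestronglyMeasurable, h.map_eq]

theorem integral_coord {G : OrientedGraph E} {μ : Measure G.ShiftSpace}
    (hμ : MeasurePreserving G.shift μ μ) (f : G.verts → ℝ) (n : ℤ) :
    ∫ x, f (x.1 n) ∂μ = ∫ x, f (x.1 0) ∂μ := by
  rcases Int.eq_nat_or_neg n with ⟨j, rfl | rfl⟩
  · rw [← integral_shift_iterate hμ j (G.measurable_coord f 0)]
    simp only [shift_iterate_apply, zero_add]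
  · rw [← integral_shift_iterate hμ j (G.measurable_coord f (-j))]
    simp only [shift_iterate_apply, neg_add_cancel]

/-- The sets that depend on finitely many coordinates. -/
def finiteWindowSets : Set (Set G.ShiftSpace) :=
  {A | ∃ m : ℕ, ∀ x y : G.ShiftSpace, (∀ j : ℤ, |j| ≤ m → x.1 j = y.1 j) → (x ∈ A ↔ y ∈ A)}

theorem isSetAlgebra_finiteWindowSets : IsSetAlgebra G.finiteWindowSets where
  empty_mem := ⟨0, fun _ _ _ => Iff.rfl⟩
  compl_mem := fun _ ⟨m, hm⟩ => ⟨m, fun x y h => not_congr (hm x y h)⟩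
  union_mem := fun _ _ ⟨m, hm⟩ ⟨m', hm'⟩ => ⟨max m m', fun x y h => or_congr
    (hm x y fun j hj => h j (hj.trans (by simp)))
    (hm' x y fun j hj => h j (hj.trans (by simp)))⟩

theorem window_eq_iff (m : ℕ) (x y : G.ShiftSpace) :
    G.window m (2 * m) x = G.window m (2 * m) y ↔ ∀ j : ℤ, |j| ≤ m → x.1 j = y.1 j := by
  constructor
  · intro h j hj
    rw [abs_le] at hj
    have := congrFun h ⟨(j + m).toNat, by omega⟩
    simp only [window] at this
    rwa [Int.toNat_of_nonneg (by omega), add_sub_cancel_right] at this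
  · intro h
    funext l
    exact h _ (by rw [abs_le]; omega)

theorem measurableSet_of_mem_finiteWindowSets [Finite G.verts] {A : Set G.ShiftSpace}
    (hA : A ∈ G.finiteWindowSets) : MeasurableSet A := by
  obtain ⟨m, hm⟩ := hA
  let : MeasurableSpace G.verts := ⊤
  have : MeasurableSingletonClass G.verts := ⟨fun _ => trivial⟩
  have hAeq : A = G.window m (2 * m) ⁻¹' (G.window m (2 * m) '' A) := by
    refine (Set.subset_preimage_image _ _).antisymm ?_
    rintro x ⟨y, hy, hxy⟩
    exact (hm y x ((G.window_eq_iff m y x).1 hxy)).1 hy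
  rw [hAeq]
  exact G.measurable_window m (2 * m) (Set.toFinite _).measurableSet

theorem measurableSpace_eq_generateFrom_finiteWindowSets [Finite G.verts] :
    (inferInstance : MeasurableSpace G.ShiftSpace) =
      MeasurableSpace.generateFrom G.finiteWindowSets := by
  refine le_antisymm ?_ (MeasurableSpace.generateFrom_le fun A hA =>
    G.measurableSet_of_mem_finiteWindowSets hA)
  let : MeasurableSpace G.verts := ⊤
  have h : @Measurable _ _ (MeasurableSpace.generateFrom G.finiteWindowSets) _
      (fun x : G.ShiftSpace => x.1) := by
    refine @measurable_pi_lambda _ _ _ (MeasurableSpace.generateFrom G.finiteWindowSets) _ _ ?_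
    intro j s _
    refine MeasurableSpace.measurableSet_generateFrom ⟨j.natAbs, fun x y hxy => ?_⟩
    simp only [mem_preimage]
    rw [hxy j (by simp)]
  exact h.comap_le

/-- A finite measurable partition is approximated by a function of finitely many coordinates. -/
theorem exists_window_approx [Finite G.verts] (μ : Measure G.ShiftSpace)
    [IsProbabilityMeasure μ] {k : ℕ} {P : G.ShiftSpace → Fin k} (hP : Measurable P) {ε : ℝ}
    (hε : 0 < ε) : ∃ (m : ℕ) (g : (Fin (2 * m + 1) → G.verts) → Fin k),
      μ.real {x | P x ≠ g (G.window m (2 * m) x)} ≤ ε := by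
  classical
  have hdense := Measure.MeasureDense.of_generateFrom_isSetAlgebra_finite (μ := μ)
    G.isSetAlgebra_finiteWindowSets G.measurableSpace_eq_generateFrom_finiteWindowSets
  obtain ⟨x₀⟩ : Nonempty G.ShiftSpace := nonempty_of_isProbabilityMeasure μ
  have hδ : 0 < ε / (k + 1) := by positivity
  choose A hA hAε using fun i : Fin k => hdense.approx (P ⁻¹' {i})
    (hP (MeasurableSet.singleton i)) (measure_ne_top _ _) (ε / (k + 1)) hδ
  choose m hm using hA
  -- Off the symmetric differences, `x` lies in exactly one `A i`, namely that of its own label;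
  -- elsewhere the choice is irrelevant.
  let sel : Set (Fin k) → Fin k := fun s => if h : s.Nonempty then h.some else P x₀
  let g' : G.ShiftSpace → Fin k := fun x => sel {i | x ∈ A i}
  let M : ℕ := Finset.univ.sup m
  have hg' : ∀ x y, G.window M (2 * M) x = G.window M (2 * M) y → g' x = g' y := by
    intro x y h
    rw [window_eq_iff] at h
    have : {i | x ∈ A i} = {i | y ∈ A i} := by
      ext i
      refine hm i x y fun j hj => h j (hj.trans ?_)
      exact_mod_cast Finset.le_sup (f := m) (Finset.mem_univ i)
    simp only [g', this]
  refine ⟨M, fun w => if h : ∃ x, G.window M (2 * M) x = w then g' h.choose else P x₀, ?_⟩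
  have hsub : {x | P x ≠ (fun w => if h : ∃ x, G.window M (2 * M) x = w then g' h.choose
      else P x₀) (G.window M (2 * M) x)} ⊆ ⋃ i, symmDiff (P ⁻¹' {i}) (A i) := by
    intro x hx
    by_contra hnot
    refine hx ?_
    have hex : ∃ y, G.window M (2 * M) y = G.window M (2 * M) x := ⟨x, rfl⟩
    simp only [dif_pos hex]
    rw [hg' _ x hex.choose_spec]
    have hmem : {i | x ∈ A i} = {P x} := by
      ext i
      have : ¬ x ∈ symmDiff (P ⁻¹' {i}) (A i) := fun h => hnot (mem_iUnion.2 ⟨i, h⟩)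
      rw [Set.mem_symmDiff] at this
      simp only [mem_preimage, mem_singleton_iff, mem_ofPred_eq] at this ⊢
      constructor
      · intro h; by_contra h'; exact this (Or.inr ⟨h, fun h => h' h.symm⟩)
      · intro h; by_contra h'; exact this (Or.inl ⟨h.symm, h'⟩)
    simp only [g', hmem, sel, singleton_nonempty, dif_pos]
    exact (mem_singleton_iff.1 (singleton_nonempty (P x)).some_mem).symm
  calc _ ≤ μ.real (⋃ i, symmDiff (P ⁻¹' {i}) (A i)) := measureReal_mono hsub
    _ ≤ ∑ i, μ.real (symmDiff (P ⁻¹' {i}) (A i)) := measureReal_iUnion_fintype_le _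
    _ ≤ ∑ _i : Fin k, ε / (k + 1) := Finset.sum_le_sum fun i _ =>
        ENNReal.toReal_le_of_le_ofReal hδ.le (hAε i).le
    _ ≤ ε := by
        rw [Finset.sum_const, Finset.card_univ, Fintype.card_fin, nsmul_eq_mul,
          ← mul_div_assoc, div_le_iff₀ (by positivity)]
        nlinarith

section Finite

variable {G} [Fintype G.verts]

open Classical in
/-- The action of the adjacency matrix on a vector. -/
noncomputable def adjSum (G : OrientedGraph E) [Fintype G.verts] (r : G.verts → ℝ) (a : G.verts) :
    ℝ :=
  ∑ b, if G.vertAdj a b then r b else 0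

theorem le_adjSum {r : G.verts → ℝ} (hr : ∀ a, 0 < r a) {a b : G.verts} (h : G.vertAdj a b) :
    r b ≤ G.adjSum r a := by
  classical
  refine le_trans ?_ (Finset.single_le_sum (fun c _ => ?_) (Finset.mem_univ b))
  · simp [h]
  · split_ifs
    exacts [(hr c).le, le_rfl]

/-- A positive vector bounds the entropy of the invariant measures. -/
theorem ksEntropy_le_integral {μ : Measure G.ShiftSpace} (hμ : μ ∈ G.invariantMeasures)
    {r : G.verts → ℝ} (hr : ∀ a, 0 < r a) :
    ksEntropy G.shift μ ≤
      ((∫ x : G.ShiftSpace, (Real.log (G.adjSum r (x.1 0)) - Real.log (r (x.1 0))) ∂μ : ℝ) :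
        EReal) := by
  classical
  obtain ⟨hprob, hinv⟩ := hμ
  let : MeasurableSpace G.verts := ⊤
  have : MeasurableSingletonClass G.verts := ⟨fun _ => trivial⟩
  set c := ∫ x : G.ShiftSpace, (Real.log (G.adjSum r (x.1 0)) - Real.log (r (x.1 0))) ∂μ with hc
  have hint : ∀ (f : G.verts → ℝ) (n : ℤ), Integrable (fun x : G.ShiftSpace => f (x.1 n)) μ :=
    fun f n => integrable_comp_of_finite (G.measurable_coord id n) f
  refine iSup_le fun k => iSup_le fun P => iSup_le fun hP => ?_
  -- The slack `d - c` pays for prediction: half for the correct ones, half for the errors, whose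
  -- frequency is at most (d - c)/2/(C + 1).
  refine EReal.le_of_forall_lt_iff_le.1 fun d hd => ?_
  have hd : c < d := EReal.coe_lt_coe_iff.1 hd
  obtain ⟨ρ, C, hC, hρ, hρ1, hρd, hρC⟩ := exists_predictionKernel k
    (show 0 < (d - c) / 2 by linarith)
  obtain ⟨m, g, hg⟩ := G.exists_window_approx μ hP
    (show 0 < (d - c) / 2 / (C + 1) by have := sub_pos.2 hd; positivity)
  -- The Markov kernel proportional to `r` along arrows. The mean cost of a step a → b is that of
  -- log (Ar)(a) - log r(b), which by invariance equals `c`.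
  set Q : G.verts → G.verts → ℝ :=
    fun a b => if G.vertAdj a b then r b / G.adjSum r a else 0 with hQdef
  have hadj0 : ∀ a, 0 ≤ G.adjSum r a := fun a => Finset.sum_nonneg fun b _ => by
    split_ifs
    exacts [(hr b).le, le_rfl]
  have hQ : ∀ a b, 0 ≤ Q a b := fun a b => by
    simp only [hQdef]
    split_ifs
    exacts [div_nonneg (hr b).le (hadj0 a), le_rfl]
  have hQ1 : ∀ a, ∑ b, Q a b ≤ 1 := fun a => by
    have : ∑ b, Q a b = G.adjSum r a / G.adjSum r a := by
      rw [adjSum, Finset.sum_div]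
      refine Finset.sum_congr rfl fun b _ => ?_
      simp only [hQdef, adjSum]
      split_ifs <;> simp
    rw [this]
    exact div_self_le_one _
  have hQpos : ∀ a b, G.vertAdj a b → 0 < Q a b := fun a b h => by
    simp only [hQdef, h, if_true]
    exact div_pos (hr b) ((hr b).trans_le (le_adjSum hr h))
  have hQlog : ∀ a b, G.vertAdj a b →
      -Real.log (Q a b) = Real.log (G.adjSum r a) - Real.log (r b) := fun a b h => by
    simp only [hQdef, h, if_true]
    rw [Real.log_div (hr b).ne' ((hr b).trans_le (le_adjSum hr h)).ne']
    ring
  have hstep : ∀ (x : G.ShiftSpace) (N : ℕ) (l : Fin N),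
      G.vertAdj (G.window m N x l.castSucc) (G.window m N x l.succ) := fun x N l => by
    have h := x.2 ((l : ℤ) - m)
    have e : ((l : ℤ) - m + 1) = ((l.succ : Fin (N + 1)) : ℕ) - (m : ℤ) := by
      rw [Fin.val_succ]; push_cast; ring
    rw [e] at h
    exact h
  -- Predicting `n` labels requires `m` extra coordinates on each side; their cost does not grow
  -- with `n`.
  refine partitionEntropy_le_of_linear (C := Real.log (Fintype.card G.verts) + 2 * m * c)
    fun n => ?_
  have hcode := sum_negMulLog_le_of_prediction (μ := μ) (G.measurable_window m (n + 2 * m))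
    (measurable_label G.measurable_shift hP n) (markovWeight_nonneg hQ)
    (sum_markovWeight_le_one hQ hQ1 _)
    (fun x => by
      have : Nonempty G.verts := ⟨x.1 0⟩
      exact mul_pos (inv_pos.2 (Nat.cast_pos.2 Fintype.card_pos))
        (Finset.prod_pos fun l _ => hQpos _ _ (hstep x _ l)))
    hρ hρ1 (fun i w => g fun j => w ⟨i + j, by omega⟩)
  simp only [joinEntropy, setOf_label_eq]
  refine hcode.trans ?_
  have h1 : ∫ x, -Real.log (markovWeight Q (G.window m (n + 2 * m) x)) ∂μ =
      Real.log (Fintype.card G.verts) + (n + 2 * m : ℕ) * c := by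
    have : ∀ x, -Real.log (markovWeight Q (G.window m (n + 2 * m) x)) =
        Real.log (Fintype.card G.verts) + ∑ l : Fin (n + 2 * m),
          (Real.log (G.adjSum r (x.1 ((l : ℤ) - m))) - Real.log (r (x.1 ((l : ℤ) - m + 1)))) := by
      intro x
      rw [neg_log_markovWeight fun l => hQpos _ _ (hstep x _ l)]
      congr 1
      refine Finset.sum_congr rfl fun l _ => ?_
      rw [hQlog _ _ (hstep x _ l)]
      simp only [window, Fin.val_castSucc, Fin.val_succ]
      push_cast
      ring_nf
    simp_rw [this]
    have hi : ∀ l : Fin (n + 2 * m), Integrable (fun x : G.ShiftSpace =>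
        Real.log (G.adjSum r (x.1 ((l : ℤ) - m))) - Real.log (r (x.1 ((l : ℤ) - m + 1)))) μ :=
      fun l => (hint (fun a => Real.log (G.adjSum r a)) _).sub (hint (fun a => Real.log (r a)) _)
    rw [integral_add (integrable_const _) (integrable_finsetSum _ fun l _ => hi l),
      integral_finsetSum _ fun l _ => hi l]
    have hl : ∀ l : Fin (n + 2 * m), ∫ x : G.ShiftSpace,
        (Real.log (G.adjSum r (x.1 ((l : ℤ) - m))) - Real.log (r (x.1 ((l : ℤ) - m + 1)))) ∂μ =
        c := fun l => by
      rw [hc, integral_sub (hint (fun a => Real.log (G.adjSum r a)) _)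
        (hint (fun a => Real.log (r a)) _), integral_sub
        (hint (fun a => Real.log (G.adjSum r a)) _) (hint (fun a => Real.log (r a)) _),
        integral_coord hinv (fun a => Real.log (G.adjSum r a)),
        integral_coord hinv (fun a => Real.log (r a)) ((l : ℤ) - m + 1)]
    rw [Finset.sum_congr rfl fun l _ => hl l]
    simp
  have h2 : ∀ i : Fin n, ∫ x, -Real.log (ρ (P (G.shift^[i] x))
      (g fun j => G.window m (n + 2 * m) x ⟨i + j, by omega⟩)) ∂μ ≤ d - c := by
    intro i
    have hwin : ∀ x, (fun j : Fin (2 * m + 1) => G.window m (n + 2 * m) x ⟨i + j, by omega⟩) =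
        G.window m (2 * m) (G.shift^[i] x) := fun x => funext fun j => by
      simp only [window, shift_iterate_apply]
      push_cast
      ring_nf
    simp_rw [hwin]
    have hpair : Measurable fun x : G.ShiftSpace => (P x, G.window m (2 * m) x) :=
      hP.prodMk (G.measurable_window m (2 * m))
    have hmeas : Measurable fun x => -Real.log (ρ (P x) (g (G.window m (2 * m) x))) :=
      (Measurable.of_discrete (f := fun y : Fin k × (Fin (2 * m + 1) → G.verts) =>
        -Real.log (ρ y.1 (g y.2)))).comp hpair
    rw [integral_shift_iterate hinv i hmeas]
    have hset : MeasurableSet {x | P x ≠ g (G.window m (2 * m) x)} :=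
      hpair (MeasurableSet.of_discrete
        (s := {y : Fin k × (Fin (2 * m + 1) → G.verts) | y.1 ≠ g y.2}))
    calc ∫ x, -Real.log (ρ (P x) (g (G.window m (2 * m) x))) ∂μ
        ≤ ∫ x, ((d - c) / 2 +
          {x | P x ≠ g (G.window m (2 * m) x)}.indicator (fun _ => C) x) ∂μ := by
          refine integral_mono (integrable_comp_of_finite hpair
            fun y => -Real.log (ρ y.1 (g y.2)))
            ((integrable_const _).add ((integrable_const _).indicator hset)) fun x => ?_
          by_cases hx : P x = g (G.window m (2 * m) x)
          · simpa [← hx] using hρd (P x)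
          · simpa [hx] using hρC (P x) (g (G.window m (2 * m) x))
      _ = (d - c) / 2 + μ.real {x | P x ≠ g (G.window m (2 * m) x)} * C := by
          rw [integral_add (integrable_const _) ((integrable_const _).indicator hset),
            integral_indicator_const _ hset]
          simp
      _ ≤ (d - c) / 2 + (d - c) / 2 / (C + 1) * C := by gcongr
      _ ≤ d - c := by
          have h3 : (d - c) / 2 / (C + 1) * C ≤ (d - c) / 2 := by
            rw [div_mul_eq_mul_div, div_le_iff₀ (by positivity)]
            nlinarith
          linarith
  have h3 := Finset.sum_le_sum fun (i : Fin n) (_ : i ∈ Finset.univ) => h2 i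
  rw [Finset.sum_const, Finset.card_univ, Fintype.card_fin, nsmul_eq_mul] at h3
  rw [h1]
  push_cast
  linarith

end Finite

end OrientedGraph

/-! ### Maximal measures of finite connected graphs -/

namespace OrientedGraph

variable {E : Type*} {G : OrientedGraph E}

theorem reflTransGen_vertAdj {a b : E} (h : Relation.ReflTransGen G.Adj a b) (ha : a ∈ G.verts)
    (hb : b ∈ G.verts) : Relation.ReflTransGen G.vertAdj ⟨a, ha⟩ ⟨b, hb⟩ := by
  induction h using Relation.ReflTransGen.head_induction_on with
  | refl => exact .refl
  | head h _ ih => exact .head (show G.vertAdj ⟨_, ha⟩ ⟨_, G.right_mem h⟩ from h) (ih _)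

theorem measurableSet_coord_mem (G : OrientedGraph E) (s : Set G.verts) (n : ℤ) :
    MeasurableSet {x : G.ShiftSpace | x.1 n ∈ s} :=
  @measurable_coord E G G.verts ⊤ id n s trivial

variable [Fintype G.verts]

theorem walkCount_le_exp_pow {h : ℝ} (hG : G.entropy ≤ h) (v : G.verts) (p : ℕ) :
    (walkCount G.vertAdj v p v : ℝ) ≤ Real.exp h ^ p :=
  G.encard_closedPaths_le hG p (G.walkCount_le_encard_closedPaths v p)

/-- The generating function of the walks from `a` to `v`, at `z`. -/
noncomputable def walkSum (G : OrientedGraph E) [Fintype G.verts] (v : G.verts) (z : ℝ)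
    (a : G.verts) : ℝ :=
  ∑' p, (walkCount G.vertAdj v p a : ℝ) * z ^ p

theorem summable_walkCount_mul_pow (hconn : G.IsConnected) {v : G.verts} {z : ℝ} (hz : 0 < z)
    (hs : Summable fun p => (walkCount G.vertAdj v p v : ℝ) * z ^ p) (a : G.verts) :
    Summable fun p => (walkCount G.vertAdj v p a : ℝ) * z ^ p := by
  obtain ⟨m, hm⟩ := exists_walkCount_le_walkCount_add (v := v)
    (reflTransGen_vertAdj (hconn v v.2 a a.2) v.2 a.2)
  -- Prefixing a fixed path of length `m` from `v` to `a` bounds the walks from `a` by closed walks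
  -- at `v`.
  have hs' := ((summable_nat_add_iff m).2 hs).mul_right (z ^ m)⁻¹
  refine Summable.of_nonneg_of_le (fun p => by positivity) (fun p => ?_) hs'
  rw [pow_add, mul_assoc, mul_assoc, mul_inv_cancel₀ (by positivity), mul_one]
  exact mul_le_mul_of_nonneg_right (by exact_mod_cast hm p) (by positivity)

theorem walkSum_pos (hconn : G.IsConnected) {v : G.verts} {z : ℝ} (hz : 0 < z)
    (hs : Summable fun p => (walkCount G.vertAdj v p v : ℝ) * z ^ p) (a : G.verts) :
    0 < G.walkSum v z a := by
  obtain ⟨m, hm⟩ := exists_walkCount_le_walkCount_add (v := v)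
    (reflTransGen_vertAdj (hconn a a.2 v v.2) a.2 v.2)
  have hm0 := hm 0
  rw [walkCount_zero_self, zero_add] at hm0
  refine (summable_walkCount_mul_pow hconn hz hs a).tsum_pos (fun p => by positivity) m ?_
  have : (0 : ℝ) < walkCount G.vertAdj v m a := by exact_mod_cast hm0
  positivity

-- Removing the first step shifts the series by one; the defect at `v` is the walk of length zero.
open Classical in
theorem mul_adjSum_walkSum (hconn : G.IsConnected) {v : G.verts} {z : ℝ} (hz : 0 < z)
    (hs : Summable fun p => (walkCount G.vertAdj v p v : ℝ) * z ^ p) (a : G.verts) :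
    z * G.adjSum (G.walkSum v z) a = G.walkSum v z a - if a = v then 1 else 0 := by
  have hsum := summable_walkCount_mul_pow hconn hz hs
  have h1 : G.adjSum (G.walkSum v z) a =
      ∑' p, ∑ b, (if G.vertAdj a b then (walkCount G.vertAdj v p b : ℝ) * z ^ p else 0) := by
    rw [Summable.tsum_finsetSum]
    · refine Finset.sum_congr rfl fun b _ => ?_
      by_cases h : G.vertAdj a b <;> simp [h, walkSum]
    · intro b _
      by_cases h : G.vertAdj a b
      · simpa [h] using hsum b
      · simp [h]
  rw [h1, walkSum, (hsum a).tsum_eq_zero_add, ← tsum_mul_left]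
  have h2 : (walkCount G.vertAdj v 0 a : ℝ) * z ^ 0 = if a = v then 1 else 0 := by
    simp [walkCount]
  rw [h2, add_sub_cancel_left]
  refine tsum_congr fun p => ?_
  rw [walkCount, Nat.cast_sum, Finset.sum_mul, Finset.mul_sum]
  refine Finset.sum_congr rfl fun b _ => ?_
  by_cases h : G.vertAdj a b
  · simp [h]
    ring
  · simp [h]

/-- The mass that a maximal measure gives to a vertex is controlled by the generating function of
the closed paths. -/
theorem IsMaximalMeasure.measureReal_vertex_le {μ : Measure G.ShiftSpace}
    (hμ : G.IsMaximalMeasure μ) (hconn : G.IsConnected) {h s : ℝ} (hG : G.entropy = h)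
    (hs : h < s) (v : G.verts) :
    μ.real {x | x.1 0 = v} ≤ (s - h) * G.walkSum v (Real.exp (-s)) v := by
  classical
  have := hμ.1.1
  set z := Real.exp (-s) with hzdef
  have hz : 0 < z := Real.exp_pos _
  have hsum : Summable fun p => (walkCount G.vertAdj v p v : ℝ) * z ^ p :=
    summable_mul_pow_of_le_pow (fun _ => by positivity) hz (Real.exp_pos h)
      (walkCount_le_exp_pow hG.le v) (by rw [hzdef, ← Real.exp_add, Real.exp_lt_one_iff]; linarith)
  set r := G.walkSum v z with hrdef
  have hr : ∀ a, 0 < r a := walkSum_pos hconn hz hsum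
  have hle := ksEntropy_le_integral hμ.1 hr
  rw [hμ.2, hG, EReal.coe_le_coe_iff] at hle
  have hset : MeasurableSet {x : G.ShiftSpace | x.1 0 = v} := G.measurableSet_coord_mem {v} 0
  have hpt : ∀ x : G.ShiftSpace, Real.log (G.adjSum r (x.1 0)) - Real.log (r (x.1 0)) ≤
      s - {x : G.ShiftSpace | x.1 0 = v}.indicator (fun _ => (r v)⁻¹) x := by
    intro x
    have hadj : 0 < G.adjSum r (x.1 0) := (hr (x.1 (0 + 1))).trans_le (le_adjSum hr (x.2 0))
    have hmul := mul_adjSum_walkSum hconn hz hsum (x.1 0)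
    have hlog : Real.log (z * G.adjSum r (x.1 0)) = -s + Real.log (G.adjSum r (x.1 0)) := by
      rw [Real.log_mul hz.ne' hadj.ne', hzdef, Real.log_exp]
    have hzpos : 0 < z * G.adjSum r (x.1 0) := mul_pos hz hadj
    by_cases hx : x.1 0 = v
    · have hmem : x ∈ {x : G.ShiftSpace | x.1 0 = v} := hx
      rw [Set.indicator_of_mem hmem]
      rw [if_pos hx, hx, ← hrdef] at hmul
      rw [hx] at hlog hzpos ⊢
      -- Here z(Ar)(v)/r(v) = 1 - 1/r(v), whose log is at most -1/r(v).
      have h1 := Real.log_le_sub_one_of_pos (div_pos hzpos (hr v))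
      rw [Real.log_div hzpos.ne' (hr v).ne', hlog, hmul, sub_div, div_self (hr v).ne',
        one_div] at h1
      linarith
    · have hmem : x ∉ {x : G.ShiftSpace | x.1 0 = v} := hx
      rw [Set.indicator_of_notMem hmem]
      rw [if_neg hx, sub_zero, ← hrdef] at hmul
      rw [hmul] at hlog
      linarith
  have hint : ∀ f : G.verts → ℝ, Integrable (fun x : G.ShiftSpace => f (x.1 0)) μ := by
    let : MeasurableSpace G.verts := ⊤
    have : MeasurableSingletonClass G.verts := ⟨fun _ => trivial⟩
    exact fun f => integrable_comp_of_finite (G.measurable_coord id 0) f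
  have hbound : ∫ x : G.ShiftSpace, (Real.log (G.adjSum r (x.1 0)) - Real.log (r (x.1 0))) ∂μ ≤
      s - μ.real {x | x.1 0 = v} * (r v)⁻¹ := by
    have hind : Integrable ({x : G.ShiftSpace | x.1 0 = v}.indicator fun _ => (r v)⁻¹) μ :=
      (integrable_const _).indicator hset
    have hsub : Integrable (fun x : G.ShiftSpace =>
        s - {x : G.ShiftSpace | x.1 0 = v}.indicator (fun _ => (r v)⁻¹) x) μ :=
      (integrable_const s).sub hind
    refine (integral_mono (hint fun a => Real.log (G.adjSum r a) - Real.log (r a))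
      hsub hpt).trans (le_of_eq ?_)
    rw [integral_sub (integrable_const _) hind,
      integral_indicator_const _ hset]
    simp
  have hfin : μ.real {x : G.ShiftSpace | x.1 0 = v} * (r v)⁻¹ ≤ s - h := by linarith
  rwa [mul_inv_le_iff₀ (hr v)] at hfin

/-- If the closed paths with first returns of length at most `M` grow slower than all the closed
paths, the generating function of the latter is bounded just beyond its radius of convergence. -/
theorem walkSum_le {h h₀ h₁ : ℝ} (hG : G.entropy ≤ h) (v : G.verts) {M : ℕ} (hM : 0 < M)
    (hclock : ∀ p, (clockCount G.vertAdj v M p M v : ℝ) ≤ Real.exp h₀ ^ p) (h01 : h₀ < h₁)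
    (h1 : h₁ ≤ h) :
    G.walkSum v (Real.exp (-(h + 1 / M))) v ≤
      ((1 - Real.exp (-(h₁ - h₀))) * (1 - Real.exp (-1)))⁻¹ := by
  set δ := 1 - Real.exp (-(h₁ - h₀)) with hδ
  have hδ0 : 0 < δ := by
    have : Real.exp (-(h₁ - h₀)) < 1 := Real.exp_lt_one_iff.2 (by linarith)
    linarith
  have he : 0 < 1 - Real.exp (-1) := by
    have : Real.exp (-1) < 1 := Real.exp_lt_one_iff.2 (by norm_num)
    linarith
  have hM' : (0 : ℝ) < M := by exact_mod_cast hM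
  set f : ℕ → ℝ := fun i => (firstPassageCount G.vertAdj v i v : ℝ) with hf
  set z := Real.exp (-(h + 1 / M)) with hz
  have hf0 : ∀ i, 0 ≤ f i := fun i => Nat.cast_nonneg _
  have hN0 : ∀ p, (0 : ℝ) ≤ walkCount G.vertAdj v p v := fun p => Nat.cast_nonneg _
  have hN00 : (walkCount G.vertAdj v 0 v : ℝ) = 1 := by rw [walkCount_zero_self, Nat.cast_one]
  have hNrec : ∀ p, (walkCount G.vertAdj v (p + 1) v : ℝ) =
      ∑ ij ∈ Finset.HasAntidiagonal.antidiagonal p, f ij.1 * walkCount G.vertAdj v ij.2 v :=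
    fun p => by rw [walkCount_succ_eq_sum_antidiagonal]; push_cast; rfl
  have hgrow := walkCount_le_exp_pow hG v
  have hfull := renewal_sum_le_one hf0 hN0 hN00 hNrec (Real.exp_pos h) hgrow
  have htrunc := renewal_sum_le_one (f := fun i => if i < M then f i else 0)
    (N := fun p => (clockCount G.vertAdj v M p M v : ℝ))
    (fun i => by split_ifs; exacts [hf0 i, le_rfl]) (fun p => Nat.cast_nonneg _)
    (by simp [clockCount])
    (fun p => by
      rw [clockCount_succ_eq_sum_antidiagonal]
      push_cast
      rfl)
    (Real.exp_pos h₀) hclock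
  obtain ⟨hsf, hren⟩ := renewal_tsum hf0 hN0 hN00 hNrec (Real.exp_pos _)
    (summable_mul_pow_of_le_pow hN0 (Real.exp_pos _) (Real.exp_pos h) hgrow
      (show Real.exp h * z < 1 by
        rw [hz, ← Real.exp_add, Real.exp_lt_one_iff]
        have : 0 < 1 / (M : ℝ) := by positivity
        linarith))
  -- Termwise, F(z) ≤ e^{-1} F(e^{-h}) + (1 - e^{-1}) e^{-(h₁-h₀)} F_M(e^{-h₀}), and both series are
  -- at most 1.
  have hF : ∑' i, f i * z ^ (i + 1) ≤ 1 - δ * (1 - Real.exp (-1)) := by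
    refine hsf.tsum_le_of_sum_le fun t => ?_
    have hterm : ∀ i ∈ t, f i * z ^ (i + 1) ≤ Real.exp (-1) * (f i * (Real.exp h)⁻¹ ^ (i + 1)) +
        (1 - Real.exp (-1)) * (Real.exp (-(h₁ - h₀)) *
          ((if i < M then f i else 0) * (Real.exp h₀)⁻¹ ^ (i + 1))) := by
      intro i _
      have hi0 : (0 : ℝ) ≤ i := Nat.cast_nonneg i
      have hze : z ^ (i + 1) = (Real.exp h)⁻¹ ^ (i + 1) * Real.exp (-((i + 1) / M)) := by
        rw [hz, ← Real.exp_neg, ← Real.exp_nat_mul, ← Real.exp_nat_mul, ← Real.exp_add]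
        congr 1
        push_cast
        ring
      have hb : 0 ≤ f i * (Real.exp h)⁻¹ ^ (i + 1) := mul_nonneg (hf0 i) (by positivity)
      rw [hze, ← mul_assoc]
      by_cases hi : i < M
      · rw [if_pos hi]
        -- Lengths are at least 1, so passing from e^{-h₀} to e^{-h} gains at least one factor
        -- e^{-(h₁-h₀)}.
        have hexp : (Real.exp h)⁻¹ ^ (i + 1) ≤
            Real.exp (-(h₁ - h₀)) * (Real.exp h₀)⁻¹ ^ (i + 1) := by
          rw [← Real.exp_neg, ← Real.exp_neg, ← Real.exp_nat_mul, ← Real.exp_nat_mul,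
            ← Real.exp_add, Real.exp_le_exp]
          push_cast
          nlinarith
        have h2 : f i * (Real.exp h)⁻¹ ^ (i + 1) ≤
            Real.exp (-(h₁ - h₀)) * (f i * (Real.exp h₀)⁻¹ ^ (i + 1)) := by
          calc _ ≤ f i * (Real.exp (-(h₁ - h₀)) * (Real.exp h₀)⁻¹ ^ (i + 1)) :=
                mul_le_mul_of_nonneg_left hexp (hf0 i)
            _ = _ := by ring
        have h3 : Real.exp (-(((i : ℝ) + 1) / M)) ≤ 1 := Real.exp_le_one_iff.2 (by
          have : 0 ≤ ((i : ℝ) + 1) / M := by positivity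
          linarith)
        have h4 := mul_le_mul_of_nonneg_left h3 hb
        have h5 := mul_le_mul_of_nonneg_left h2 he.le
        linarith
      · rw [if_neg hi, zero_mul, mul_zero, mul_zero, add_zero, mul_comm]
        refine mul_le_mul_of_nonneg_right (Real.exp_le_exp.2 (neg_le_neg ?_)) hb
        rw [le_div_iff₀ hM', one_mul]
        have : (M : ℝ) ≤ i := by exact_mod_cast not_lt.1 hi
        linarith
    refine (Finset.sum_le_sum hterm).trans ?_
    rw [Finset.sum_add_distrib, ← Finset.mul_sum, ← Finset.mul_sum, ← Finset.mul_sum]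
    have h2 := mul_le_mul_of_nonneg_left (hfull t) (Real.exp_pos (-1)).le
    have h3 := mul_le_mul_of_nonneg_left (mul_le_mul_of_nonneg_left (htrunc t)
      (Real.exp_pos (-(h₁ - h₀))).le) he.le
    have h4 : Real.exp (-(h₁ - h₀)) = 1 - δ := by rw [hδ]; ring
    rw [h4] at h3 ⊢
    nlinarith
  have hR0 : 0 ≤ G.walkSum v z v := tsum_nonneg fun p => by positivity
  change G.walkSum v z v = 1 + (∑' i, f i * z ^ (i + 1)) * G.walkSum v z v at hren
  have hFR := mul_le_mul_of_nonneg_right hF hR0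
  rw [inv_eq_one_div, le_div_iff₀ (by positivity)]
  linarith

end OrientedGraph

/-! ### Mass of a set of vertices, and conclusion -/

namespace OrientedGraph

variable {E : Type*} {G : OrientedGraph E}

/-- The constant vector bounds the entropy by the mean of the log of the out-degree. -/
theorem IsMaximalMeasure.entropy_ne_top [Fintype G.verts] {μ : Measure G.ShiftSpace}
    (hμ : G.IsMaximalMeasure μ) : G.entropy ≠ ⊤ := by
  have := ksEntropy_le_integral hμ.1 (r := fun _ => 1) fun _ => one_pos
  rw [hμ.2] at this
  exact ne_top_of_le_ne_top (EReal.coe_ne_top _) this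

/-- The mass that a maximal measure gives to a set of vertices at which the closed paths with
bounded first returns grow slowly. -/
theorem IsMaximalMeasure.measure_coord_mem_le {μ : Measure G.ShiftSpace}
    (hμ : G.IsMaximalMeasure μ) (hfin : G.verts.Finite) (hconn : G.IsConnected) {h₀ h₁ : ℝ}
    (h01 : h₀ < h₁) (h1 : (h₁ : EReal) < G.entropy) {M : ℕ} (hM : 0 < M) {s : Set E} {K : ℕ}
    (hK : (G.verts ∩ s).encard ≤ K)
    (hgrow : ∀ v ∈ G.verts ∩ s, ∀ p N : ℕ, (N : ℕ∞) ≤ (G.closedPathsLE v p M).encard →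
      (N : ℝ) ≤ Real.exp h₀ ^ p) :
    μ {x | (x.1 0 : E) ∈ s} ≤
      ENNReal.ofReal (K * ((1 - Real.exp (-(h₁ - h₀))) * (1 - Real.exp (-1)))⁻¹ / M) := by
  classical
  have : Fintype G.verts := hfin.fintype
  have := hμ.1.1
  obtain ⟨h, hh⟩ : ∃ h : ℝ, G.entropy = h :=
    ⟨G.entropy.toReal, (EReal.coe_toReal hμ.entropy_ne_top (ne_bot_of_gt h1)).symm⟩
  have h1' : h₁ < h := by rw [hh] at h1; exact EReal.coe_lt_coe_iff.1 h1
  set C := ((1 - Real.exp (-(h₁ - h₀))) * (1 - Real.exp (-1)))⁻¹ with hC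
  have hM' : (0 : ℝ) < M := by exact_mod_cast hM
  have hC0 : 0 ≤ C := by
    have e1 : Real.exp (-(h₁ - h₀)) ≤ 1 := Real.exp_le_one_iff.2 (by linarith)
    have e2 : Real.exp (-1) ≤ 1 := Real.exp_le_one_iff.2 (by norm_num)
    exact inv_nonneg.2 (mul_nonneg (by linarith) (by linarith))
  have hv : ∀ v : G.verts, (v : E) ∈ s → μ.real {x | x.1 0 = v} ≤ C / M := by
    intro v hvs
    -- The excess 1/M over h is the gain in the final bound, yet large enough to damp returns longer
    -- than `M`.
    have hle := hμ.measureReal_vertex_le hconn hh (s := h + 1 / M)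
      (by have : 0 < 1 / (M : ℝ) := by positivity
          linarith) v
    have hw := walkSum_le hh.le v hM (fun p => hgrow v ⟨v.2, hvs⟩ p _
      (G.clockCount_le_encard_closedPathsLE v p M)) h01 h1'.le
    refine hle.trans ?_
    rw [add_sub_cancel_left, div_eq_mul_one_div C, mul_comm C]
    exact mul_le_mul_of_nonneg_left hw (by positivity)
  set T : Finset G.verts := Finset.univ.filter fun v => (v : E) ∈ s with hT
  have hcard : (T.card : ℝ) ≤ K := by
    have h2 : (T.card : ℕ∞) ≤ (G.verts ∩ s).encard := by
      rw [← Set.encard_coe_eq_coe_finsetCard, ← Subtype.val_injective.encard_image]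
      refine Set.encard_le_encard ?_
      rintro _ ⟨v, hvT, rfl⟩
      exact ⟨v.2, by simpa [hT] using hvT⟩
    exact_mod_cast h2.trans hK
  have hsub : {x : G.ShiftSpace | (x.1 0 : E) ∈ s} ⊆ ⋃ v ∈ T, {x : G.ShiftSpace | x.1 0 = v} := by
    intro x hx
    simp only [mem_iUnion]
    exact ⟨x.1 0, by simpa [hT] using hx, rfl⟩
  rw [← ofReal_measureReal]
  refine ENNReal.ofReal_le_ofReal ?_
  calc μ.real {x | (x.1 0 : E) ∈ s} ≤ μ.real (⋃ v ∈ T, {x : G.ShiftSpace | x.1 0 = v}) :=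
        measureReal_mono hsub (measure_ne_top _ _)
    _ ≤ ∑ v ∈ T, μ.real {x : G.ShiftSpace | x.1 0 = v} := measureReal_biUnion_finset_le _ _
    _ ≤ ∑ _v ∈ T, C / M := Finset.sum_le_sum fun v hvT => hv v (by simpa [hT] using hvT)
    _ = T.card * (C / M) := by rw [Finset.sum_const, nsmul_eq_mul]
    _ ≤ K * (C / M) := mul_le_mul_of_nonneg_right hcard (by positivity)
    _ = K * C / M := by ring

end OrientedGraph

theorem mainTheorem3 {E W Λ : Type*} (F : Λ → Set E) (hF : (⋃ L, F L) = Set.univ)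
    (G : ℕ → OrientedGraph E) (hG : OrientedGraph.IsUniform F G)
    (H : OrientedGraph W) (hconv : OrientedGraph.ConvergesTo F G H)
    (G' : ℕ → OrientedGraph E) (hsub : ∀ n, (G' n).IsSubgraph (G n))
    (hfin : ∀ n, (G' n).verts.Finite) (hconn : ∀ n, (G' n).IsConnected)
    (ℓ : EReal) (hlim : Tendsto (fun n => (G' n).entropy) atTop (𝓝 ℓ)) (hlt : H.entropy < ℓ)
    (μ : ∀ n, Measure (G' n).ShiftSpace) (hμ : ∀ n, (G' n).IsMaximalMeasure (μ n)) :
    OrientedGraph.GoesToInfinity F G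
      (fun n => (μ n).map (OrientedGraph.shiftInclusion (hsub n))) := by
  intro L
  -- Real separators cover `H.entropy = ⊥` and `ℓ = ⊤` as well, and make the constant `C`
  -- independent of `n`.
  obtain ⟨h₀, hH₀, h₀ℓ⟩ := EReal.lt_iff_exists_real_btwn.1 hlt
  obtain ⟨h₁, h₀₁, h₁ℓ⟩ := EReal.lt_iff_exists_real_btwn.1 h₀ℓ
  obtain ⟨K, hK⟩ := ENat.ne_top_iff_exists.1 (hG.2 L).ne
  set C := ((1 - Real.exp (-(h₁ - h₀))) * (1 - Real.exp (-1)))⁻¹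
  have hsmall : Tendsto (fun M : ℕ => ENNReal.ofReal (K * C / M)) atTop (𝓝 0) := by
    simpa using ENNReal.tendsto_ofReal (tendsto_const_div_atTop_nhds_zero_nat (K * C))
  rw [ENNReal.tendsto_nhds_zero] at hsmall ⊢
  intro ε hε
  -- `M` is fixed before `n`, as the rank in the convergence of the graphs depends on it.
  obtain ⟨M, hMε, hM⟩ := ((hsmall ε hε).and (eventually_gt_atTop 0)).exists
  obtain ⟨n₀, hn₀⟩ := hconv L M hM
  filter_upwards [eventually_gt_atTop n₀, hlim.eventually_const_lt h₁ℓ] with n hn hent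
  have hcyl : MeasurableSet ((G n).cylinder (F L)) :=
    (G n).measurableSet_coord_mem {v | (v : E) ∈ F L} 0
  rw [Measure.map_apply (OrientedGraph.measurable_shiftInclusion (hsub n)) hcyl]
  refine le_trans ?_ hMε
  refine (hμ n).measure_coord_mem_le (hfin n) (hconn n) (EReal.coe_lt_coe_iff.1 h₀₁) hent hM ?_ ?_
  · rw [hK]
    exact (Set.encard_le_encard (Set.inter_subset_inter_left _ (hsub n).1)).trans
      (le_iSup (fun i => ((G i).verts ∩ F L).encard) n)
  · intro v hv p N hN
    obtain ⟨u, -, hu⟩ := hn₀ n hn v ⟨(hsub n).1 hv.1, hv.2⟩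
    exact H.encard_closedPaths_le hH₀.le p ((hN.trans (Set.encard_le_encard
      (OrientedGraph.closedPathsLE_mono (hsub n) v p M))).trans (hu p))
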